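/- A tree on the vertex set $[k]=\{1,\dots,k\}$, rooted at $1$, is called recursive if the labels of the vertices increase along every branch from the root. For $k\ge 1$ let $T_k$ be uniformly distributed on the $(k-1)!$ recursive trees on $[k]$. Fix $c>0$ and let $(q_k)_{k\ge 1}$ be a sequence in $[0,1]$ with $$q_k = 1 - c\,k^{-1/4} + o(k^{-1}) \qquad (k\to\infty).$$ Given $T_k$, perform Bernoulli bond percolation with parameter $q_k$, that is, keep each edge with probability $q_k$ and remove it with probability $1-q_k$, independently of the other edges, and let $\Delta_k$ be the number of vertices of $T_k$ that are disconnected from the root $1$. Then, as $k\to\infty$, there is convergence in law $$k^{-3/4}\Delta_k - \frac34\, c\ln k \;\Longrightarrow\; c\,(Z+\ln c),$$ where $Z$ is a real random variable with the continuous Luria-Delbrück law, i.e. with characteristic function $$\mathbb{E}\left(e^{i\theta Z}\right)=\exp\left(-\frac{\pi}{2}|\theta| - i\theta\ln|\theta|\right),\qquad \theta\in\mathbb{R}$$ (with value $1$ at $\theta=0$). -/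

import Mathlib

open MeasureTheory ProbabilityTheory Filter

noncomputable section

namespace RandomRecursiveTree

/-- A tree on the ordered vertex set `Fin (n + 1)`, rooted at the smallest vertex `0`, is recursive
if the labels increase along every branch issued from the root. -/
structure IsRecursiveTree {n : ℕ} (T : SimpleGraph (Fin (n + 1))) : Prop where
  isTree : T.IsTree
  increasing : ∀ (v : Fin (n + 1)) (p : T.Walk 0 v), p.IsPath → p.support.Pairwise (· < ·)

theorem isRecursiveTree_starGraph (n : ℕ) :
    IsRecursiveTree (SimpleGraph.starGraph (0 : Fin (n + 1))) where
  isTree := SimpleGraph.isTree_starGraph 0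
  increasing := by
    intro v p hp
    cases p with
    | nil => simp
    | cons h q =>
      rw [SimpleGraph.Walk.cons_isPath_iff] at hp
      cases q with
      | nil =>
        have h' := h.ne
        simpa [Fin.pos_iff_ne_zero] using h'.symm
      | cons h2 r =>
        exfalso
        apply hp.2
        rw [SimpleGraph.starGraph_adj] at h h2
        have hx := h.1
        rcases h2.2 with h3 | h3
        · exact absurd h3.symm hx
        · subst h3
          simp

instance {V : Type*} [Countable V] : MeasurableSingletonClass (SimpleGraph V) where
  measurableSet_singleton G := by
    have h : ({G} : Set (SimpleGraph V)) = SimpleGraph.edgeSet ⁻¹' {G.edgeSet} := by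
      ext H
      simp
    rw [h]
    exact SimpleGraph.measurableEmbedding_edgeSet.measurable (measurableSet_singleton _)

/-- The law of the random recursive tree with `n + 1` vertices: the uniform distribution on the
set of recursive trees on `Fin (n + 1)`. -/
def recursiveTreeLaw (n : ℕ) : Measure (SimpleGraph (Fin (n + 1))) :=
  uniformOn {T | IsRecursiveTree T}

/-- Bernoulli bond percolation on `G` with parameter `q`: each edge of `G` is kept with probability
`q` and removed with probability `1 - q`, independently of the other edges. This is the law of the
graph formed by the edges that are kept, on the same vertex set. -/
def percolation {V : Type*} (G : SimpleGraph V) (q : unitInterval) : Measure (SimpleGraph V) :=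
  (setBernoulli G.edgeSet q).map SimpleGraph.fromEdgeSet

/-- The law of the graph obtained by first sampling a random recursive tree with `n + 1` vertices
and then, given the tree, performing Bernoulli bond percolation on it with parameter `q`. -/
def percolatedTreeLaw (n : ℕ) (q : unitInterval) : Measure (SimpleGraph (Fin (n + 1))) :=
  (recursiveTreeLaw n).bind fun T => percolation T q

instance (n : ℕ) : IsProbabilityMeasure (recursiveTreeLaw n) :=
  isProbabilityMeasure_uniformOn (Set.toFinite _) ⟨_, isRecursiveTree_starGraph n⟩

instance {V : Type*} [Countable V] (G : SimpleGraph V) (q : unitInterval) :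
    IsProbabilityMeasure (percolation G q) :=
  Measure.isProbabilityMeasure_map SimpleGraph.measurable_fromEdgeSet.aemeasurable

instance (n : ℕ) (q : unitInterval) : IsProbabilityMeasure (percolatedTreeLaw n q) :=
  isProbabilityMeasure_bind (Measurable.of_discrete).aemeasurable
    (ae_of_all _ fun _ => inferInstance)

/-- The number of vertices of `H` that are disconnected from the root `0`. -/
def numCutOff {n : ℕ} (H : SimpleGraph (Fin (n + 1))) : ℕ :=
  {v : Fin (n + 1) | ¬ H.Reachable 0 v}.ncard

/-- The continuous Luria-Delbrück law: the probability distribution on `ℝ` whose characteristic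
function is `θ ↦ exp (-(π / 2) |θ| - i θ ln |θ|)` (which is `1` at `θ = 0`). -/
def IsContinuousLuriaDelbruck (ν : ProbabilityMeasure ℝ) : Prop :=
  ∀ θ : ℝ, charFun (ν : Measure ℝ) θ =
    Complex.exp (-((Real.pi / 2 * |θ| : ℝ) : ℂ) - Complex.I * ((θ * Real.log |θ| : ℝ) : ℂ))

end RandomRecursiveTree

end

/-!
Write `N = n + 1` for the number of vertices, `D` for the number of them that are cut off from the
root, `C = N - D` and `ε = 1 - q`. A recursive tree on `N + 1` vertices is a recursive tree on `N`
vertices together with a uniformly chosen parent of the new vertex (`isRecursiveTree_iff`,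
`integral_recursiveTreeLaw_succ`), so under percolation `C` is a Markov chain that increases by `1`
with probability `q C / N` (`integral_numCutOff_succ`).

For every complex `r` this yields the exact formula
`E ∏_{1 ≤ j < C} (1 + r / j) = ∏_{1 ≤ j < N} (1 + r q / j)`, which after division by the value
of the product at `C = N` reads (`integral_prod_inv_numCutOff`)
`E ∏_{C ≤ j < N} (1 + r / j)⁻¹ = ∏_{1 ≤ j < N} (1 - ε r / (j + r))`.
Take `r = i ρ` with `ρ = -θ N ^ (1 / 4)`. The product on the left is then close to
`exp (-r D / N) = exp (i θ N ^ (-3 / 4) D)`, with an error controlled by `E D ≤ ε N (1 + log N)`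
(`integral_numCutOff_le`, `norm_integral_sub_le`). The product on the right is close to
`exp (-ε r (log (N + r) - log (1 + r)))` (`norm_prod_one_sub_sub_exp_le`,
`norm_sum_inv_sub_log_le`). Since `ε r → -i c θ` and `log (1 + r)` is about
`log |θ| + log N / 4 - i (π / 2) sign θ`, the centred characteristic function converges to
`exp (-c (π / 2) |θ| - i c θ log |θ|)` (`tendsto_log_exponent`, `tendsto_charFun_numCutOff`). Lévy's
continuity theorem gives the convergence in law and the existence of the limit, and an affine change
of variable turns the limit into `c (Z + log c)`.
-/

namespace RandomRecursiveTree

/-! ### Recursive trees grown leaf by leaf -/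

/-- A property preserved along edges holds throughout a connected component as soon as it holds at
one vertex. -/
theorem reachable_invariant {V : Type*} {G : SimpleGraph V} {P : V → Prop}
    (hP : ∀ x y, G.Adj x y → P x → P y) {u v : V} (h : G.Reachable u v) (hu : P u) : P v := by
  obtain ⟨p⟩ := h
  induction p with
  | nil => exact hu
  | cons h _ ih => exact ih (hP _ _ h hu)

theorem IsRecursiveTree.existsUnique_parent {n : ℕ} {T : SimpleGraph (Fin (n + 1))}
    (hT : IsRecursiveTree T) {i : Fin (n + 1)} (hi : i ≠ 0) : ∃! j, j < i ∧ T.Adj j i := by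
  classical
  -- any smaller neighbour `j` of `i` is the last vertex but one on the path from `0` to `i`
  obtain ⟨p, hp, hpu⟩ := hT.isTree.existsUnique_path 0 i
  have key : ∀ j, j < i → T.Adj j i → j = p.penultimate := by
    intro j hj hadj
    obtain ⟨p', hp', -⟩ := hT.isTree.existsUnique_path 0 j
    have hle : ∀ x ∈ p'.support, x ≤ j := by
      intro x hx
      have h := hT.increasing j p' hp'
      rw [← SimpleGraph.Walk.dropLast_support_concat] at h hx
      rcases List.mem_append.1 hx with hx | hx
      · exact ((List.pairwise_append.1 h).2.2 x hx j (by simp)).le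
      · simp at hx; exact hx.le
    have hni : i ∉ p'.support := fun h => absurd (hle i h) (not_le.2 hj)
    have := hpu (p'.concat hadj) (hp'.concat hni hadj)
    rw [← this, SimpleGraph.Walk.penultimate_concat]
  have hnil : ¬ p.Nil := SimpleGraph.Walk.not_nil_of_ne (Ne.symm hi)
  have hadj := p.adj_penultimate hnil
  have hlt : p.penultimate < i := by
    have h := hT.increasing i p hp
    rw [← SimpleGraph.Walk.dropLast_support_concat] at h
    refine (List.pairwise_append.1 h).2.2 _ ?_ i (by simp)
    have := p.penultimate_mem_dropLast_support hnil
    simpa using this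
  exact ⟨_, ⟨hlt, hadj⟩, fun j hj => key j hj.1 hj.2⟩

/-- A path whose first step goes up keeps going up: a vertex `w` where it turned back down would
have two distinct smaller neighbours, the one before and the one after `w` on the path. -/
theorem pairwise_lt_support_of_existsUnique_parent {n : ℕ} {T : SimpleGraph (Fin (n + 1))}
    (h : ∀ i, i ≠ 0 → ∃! j, j < i ∧ T.Adj j i) {w v : Fin (n + 1)} (p : T.Walk w v) :
    ∀ (u : Fin (n + 1)) (huw : T.Adj u w), u < w → (SimpleGraph.Walk.cons huw p).IsPath →
      (SimpleGraph.Walk.cons huw p).support.Pairwise (· < ·) := by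
  induction p with
  | nil => intro u huw hlt _; simpa using hlt
  | @cons w x v hwx p ih =>
    intro u huw hlt hp
    rw [SimpleGraph.Walk.cons_isPath_iff] at hp
    have hwx' : w < x := by
      by_contra hcon
      have hxw : x < w := lt_of_le_of_ne (not_lt.1 hcon) hwx.ne'
      have := (h w (ne_of_gt (lt_of_le_of_lt (Fin.zero_le _) hlt))).unique ⟨hlt, huw⟩
        ⟨hxw, hwx.symm⟩
      apply hp.2
      rw [this]
      simp
    have := ih w hwx hwx' hp.1
    rw [SimpleGraph.Walk.support_cons, List.pairwise_cons]
    refine ⟨fun y hy => ?_, this⟩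
    rw [SimpleGraph.Walk.support_cons, List.pairwise_cons] at this
    rw [SimpleGraph.Walk.support_cons, List.mem_cons] at hy
    rcases hy with rfl | hy
    · exact hlt
    · exact hlt.trans (this.1 y hy)

/-- A graph is a recursive tree exactly when every vertex other than the root has a unique smaller
neighbour, its parent. This local criterion is what makes recursive trees grow one leaf at a
time. -/
theorem isRecursiveTree_iff {n : ℕ} {T : SimpleGraph (Fin (n + 1))} :
    IsRecursiveTree T ↔ ∀ i, i ≠ 0 → ∃! j, j < i ∧ T.Adj j i := by
  classical
  refine ⟨fun hT i hi => hT.existsUnique_parent hi, fun h => ⟨?_, ?_⟩⟩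
  · have hreach : ∀ i, T.Reachable 0 i := by
      intro i
      induction i using WellFoundedLT.induction with
      | ind i ih =>
        by_cases hi : i = 0
        · rw [hi]
        · obtain ⟨j, ⟨hj, hadj⟩, -⟩ := h i hi
          exact (ih j hj).trans hadj.reachable
    have hconn : T.Connected := by
      rw [SimpleGraph.connected_iff_exists_forall_reachable]
      exact ⟨0, hreach⟩
    refine SimpleGraph.isTree_iff_connected_and_card.2 ⟨hconn, le_antisymm ?_ ?_⟩
    · -- mapping a vertex to the edge to its parent covers all edges, so there are at most `n`
      choose! f _ hfu using h
      have hsub : T.edgeSet ⊆ (fun i : Fin (n + 1) => s(f i, i)) '' {i | i ≠ 0} := by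
        intro e he
        induction e with
        | h a b =>
          rw [SimpleGraph.mem_edgeSet] at he
          rcases lt_or_gt_of_ne he.ne with hlt | hlt
          · have hb : b ≠ 0 := ne_of_gt (lt_of_le_of_lt (Fin.zero_le _) hlt)
            refine ⟨b, hb, ?_⟩
            rw [hfu b hb a ⟨hlt, he⟩]
          · have hb : a ≠ 0 := ne_of_gt (lt_of_le_of_lt (Fin.zero_le _) hlt)
            refine ⟨a, hb, ?_⟩
            rw [hfu a hb b
              ⟨hlt, he.symm⟩, Sym2.eq_swap]
      have h1 := (Set.ncard_le_ncard hsub (Set.toFinite _)).trans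
        (Set.ncard_image_le (Set.toFinite _))
      have h2 : ({i | i ≠ 0} : Set (Fin (n + 1))).ncard = n := by
        rw [show ({i | i ≠ 0} : Set (Fin (n + 1))) = {0}ᶜ from rfl, Set.ncard_compl]
        simp
      rw [h2] at h1
      rw [Nat.card_coe_set_eq, Nat.card_fin]
      exact Nat.add_le_add_right h1 1
    · exact hconn.card_vert_le_card_edgeSet_add_one
  · intro v p hp
    cases p with
    | nil => simp
    | cons h0 p =>
      exact pairwise_lt_support_of_existsUnique_parent h p _ h0
        (Fin.pos_iff_ne_zero.2 h0.ne') hp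

/-- The graph obtained from `H` by adding the new largest vertex `Fin.last (n + 1)` and joining it
to the old vertex `v`; the old vertices are embedded by `Fin.castSucc`. -/
def attachLeaf {n : ℕ} (H : SimpleGraph (Fin (n + 1))) (v : Fin (n + 1)) :
    SimpleGraph (Fin (n + 2)) :=
  H.map Fin.castSucc ⊔ SimpleGraph.edge v.castSucc (Fin.last (n + 1))

/-- The graph obtained from `H` by adding the new largest vertex `Fin.last (n + 1)` as an isolated
vertex; the old vertices are embedded by `Fin.castSucc`. -/
def addIsolated {n : ℕ} (H : SimpleGraph (Fin (n + 1))) : SimpleGraph (Fin (n + 2)) :=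
  H.map Fin.castSucc

section adj

variable {n : ℕ} (H : SimpleGraph (Fin (n + 1))) (v i j : Fin (n + 1))

@[simp] theorem addIsolated_adj_castSucc :
    (addIsolated H).Adj i.castSucc j.castSucc ↔ H.Adj i j :=
  SimpleGraph.map_adj_apply (f := Fin.castSuccEmb)

@[simp] theorem addIsolated_adj_last :
    ¬ (addIsolated H).Adj i.castSucc (Fin.last (n + 1)) := by
  rintro ⟨-, a, b, -, -, h⟩
  exact (Fin.castSucc_lt_last b).ne h

@[simp] theorem attachLeaf_adj_castSucc :
    (attachLeaf H v).Adj i.castSucc j.castSucc ↔ H.Adj i j := by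
  have := addIsolated_adj_castSucc H i j
  rw [addIsolated] at this
  have hi := (Fin.castSucc_lt_last i).ne
  have hj := (Fin.castSucc_lt_last j).ne
  rw [attachLeaf, SimpleGraph.sup_adj, this, SimpleGraph.edge_adj]
  simp [hi, hj]

@[simp] theorem attachLeaf_adj_last :
    (attachLeaf H v).Adj i.castSucc (Fin.last (n + 1)) ↔ i = v := by
  have := addIsolated_adj_last H i
  rw [addIsolated] at this
  have hi := (Fin.castSucc_lt_last i).ne
  have hj := (Fin.castSucc_lt_last v).ne
  rw [attachLeaf, SimpleGraph.sup_adj, SimpleGraph.edge_adj]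
  simp [this, hi]

end adj

theorem ext_castSucc {n : ℕ} {G G' : SimpleGraph (Fin (n + 2))}
    (h : ∀ i j : Fin (n + 1), G.Adj i.castSucc j.castSucc ↔ G'.Adj i.castSucc j.castSucc)
    (hl : ∀ i : Fin (n + 1), G.Adj i.castSucc (Fin.last _) ↔ G'.Adj i.castSucc (Fin.last _)) :
    G = G' := by
  ext a b
  induction a using Fin.lastCases with
  | last =>
    induction b using Fin.lastCases with
    | last => simp
    | cast b => rw [G.adj_comm, G'.adj_comm]; exact hl b
  | cast a =>
    induction b using Fin.lastCases with
    | last => exact hl a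
    | cast b => exact h a b

theorem attachLeaf_injective {n : ℕ} :
    Function.Injective fun x : SimpleGraph (Fin (n + 1)) × Fin (n + 1) => attachLeaf x.1 x.2 := by
  rintro ⟨H, v⟩ ⟨H', v'⟩ h
  simp only at h
  have h1 : H = H' := by
    ext i j
    rw [← attachLeaf_adj_castSucc H v, h, attachLeaf_adj_castSucc]
  have h2 : v = v' := by
    rw [← attachLeaf_adj_last H' v', ← h, attachLeaf_adj_last]
  rw [h1, h2]

theorem isRecursiveTree_attachLeaf_iff {n : ℕ} {H : SimpleGraph (Fin (n + 1))} {v : Fin (n + 1)} :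
    IsRecursiveTree (attachLeaf H v) ↔ IsRecursiveTree H := by
  have hcast (i : Fin (n + 1)) : (∃! j, j < i.castSucc ∧ (attachLeaf H v).Adj j i.castSucc) ↔
      ∃! j, j < i ∧ H.Adj j i := by
    constructor
    · rintro ⟨j, ⟨hj, hadj⟩, hu⟩
      induction j using Fin.lastCases with
      | last => exact absurd hj (not_lt.2 (Fin.le_last _))
      | cast j =>
        refine ⟨j, ⟨by simpa using hj, by simpa using hadj⟩, fun k hk => ?_⟩
        exact Fin.castSucc_injective _ (hu k.castSucc ⟨by simpa using hk.1, by simpa using hk.2⟩)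
    · rintro ⟨j, ⟨hj, hadj⟩, hu⟩
      refine ⟨j.castSucc, ⟨by simpa using hj, by simpa using hadj⟩, fun k hk => ?_⟩
      induction k using Fin.lastCases with
      | last => exact absurd hk.1 (not_lt.2 (Fin.le_last _))
      | cast k => rw [hu k ⟨by simpa using hk.1, by simpa using hk.2⟩]
  rw [isRecursiveTree_iff, isRecursiveTree_iff]
  constructor
  · intro h i hi
    exact (hcast i).1 (h i.castSucc (by simpa using hi))
  · intro h i hi
    induction i using Fin.lastCases with
    | last =>
      refine ⟨v.castSucc, ⟨Fin.castSucc_lt_last v, by simp⟩, fun k hk => ?_⟩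
      induction k using Fin.lastCases with
      | last => exact absurd hk.1 (lt_irrefl _)
      | cast k => rw [(attachLeaf_adj_last H v k).1 hk.2]
    | cast i => exact (hcast i).2 (h i (by simpa using hi))

theorem IsRecursiveTree.exists_eq_attachLeaf {n : ℕ} {T : SimpleGraph (Fin (n + 2))}
    (hT : IsRecursiveTree T) : ∃ H v, attachLeaf (n := n) H v = T := by
  obtain ⟨v, ⟨hv, hadj⟩, hu⟩ := isRecursiveTree_iff.1 hT (Fin.last (n + 1)) (Fin.last_pos.ne')
  induction v using Fin.lastCases with
  | last => exact absurd hv (lt_irrefl _)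
  | cast v =>
    refine ⟨T.comap Fin.castSucc, v, ext_castSucc (fun i j => ?_) (fun i => ?_)⟩
    · simp
    · rw [attachLeaf_adj_last]
      refine ⟨fun h => h ▸ hadj, fun h => Fin.castSucc_injective _ ?_⟩
      exact hu i.castSucc ⟨Fin.castSucc_lt_last i, h⟩

theorem addIsolated_reachable_castSucc {n : ℕ} (H : SimpleGraph (Fin (n + 1)))
    (i : Fin (n + 1)) : (addIsolated H).Reachable 0 i.castSucc ↔ H.Reachable 0 i := by
  constructor
  · intro h
    have := reachable_invariant (G := addIsolated H)
      (P := fun x => ∃ i : Fin (n + 1), x = i.castSucc ∧ H.Reachable 0 i) ?_ h ⟨0, rfl, .rfl⟩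
    · obtain ⟨k, hk, hr⟩ := this
      rwa [Fin.castSucc_injective _ hk]
    · rintro x y hxy ⟨k, rfl, hk⟩
      induction y using Fin.lastCases with
      | last => simp at hxy
      | cast y => exact ⟨y, rfl, hk.trans ((addIsolated_adj_castSucc H k y).1 hxy).reachable⟩
  · intro h
    exact h.map (⟨Fin.castSucc, fun h => (addIsolated_adj_castSucc H _ _).2 h⟩ :
      H →g addIsolated H)

theorem not_addIsolated_reachable_last {n : ℕ} (H : SimpleGraph (Fin (n + 1))) :
    ¬ (addIsolated H).Reachable 0 (Fin.last (n + 1)) := by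
  intro h
  refine reachable_invariant (G := addIsolated H) (P := fun x => x ≠ Fin.last (n + 1)) ?_ h
    (Fin.last_pos.ne) rfl
  rintro x y hxy hx rfl
  induction x using Fin.lastCases with
  | last => exact hx rfl
  | cast x => simp at hxy

theorem attachLeaf_reachable_castSucc {n : ℕ} (H : SimpleGraph (Fin (n + 1)))
    (v i : Fin (n + 1)) : (attachLeaf H v).Reachable 0 i.castSucc ↔ H.Reachable 0 i := by
  constructor
  · intro h
    have := reachable_invariant (G := attachLeaf H v)
      -- the new leaf carries the reachability of the vertex `v` it hangs from
      (P := fun x => ∀ i : Fin (n + 1), (x = i.castSucc ∨ (x = Fin.last _ ∧ i = v)) →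
        H.Reachable 0 i) ?_ h ?_
    · exact this i (.inl rfl)
    · intro x y hxy hx i hi
      rcases hi with rfl | ⟨rfl, rfl⟩
      · induction x using Fin.lastCases with
        | last =>
          exact hx i (.inr ⟨rfl, (attachLeaf_adj_last H v i).1 hxy.symm⟩)
        | cast x =>
          exact (hx x (.inl rfl)).trans ((attachLeaf_adj_castSucc H v x i).1 hxy).reachable
      · induction x using Fin.lastCases with
        | last => simp at hxy
        | cast x => exact hx i (.inl (by rw [(attachLeaf_adj_last H i x).1 hxy]))
    · rintro i (hi | hi)
      · rw [← Fin.castSucc_injective _ ((Fin.castSucc_zero).trans hi)]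
      · exact absurd hi.1 (Fin.last_pos.ne)
  · intro h
    exact h.map (⟨Fin.castSucc, fun h => (attachLeaf_adj_castSucc H v _ _).2 h⟩ :
      H →g attachLeaf H v)

theorem attachLeaf_reachable_last {n : ℕ} (H : SimpleGraph (Fin (n + 1))) (v : Fin (n + 1)) :
    (attachLeaf H v).Reachable 0 (Fin.last (n + 1)) ↔ H.Reachable 0 v := by
  have hadj : (attachLeaf H v).Adj v.castSucc (Fin.last (n + 1)) := by simp
  rw [← attachLeaf_reachable_castSucc H v v]
  exact ⟨fun h => h.trans hadj.symm.reachable, fun h => h.trans hadj.reachable⟩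

open scoped Classical in
theorem numCutOff_eq_sum {n : ℕ} (H : SimpleGraph (Fin (n + 1))) :
    numCutOff H = ∑ v, if H.Reachable 0 v then 0 else 1 := by
  rw [numCutOff, Set.ncard_eq_toFinset_card', Finset.sum_ite]
  simp [Set.toFinset_ofPred]

theorem numCutOff_addIsolated {n : ℕ} (H : SimpleGraph (Fin (n + 1))) :
    numCutOff (addIsolated H) = numCutOff H + 1 := by
  classical
  rw [numCutOff_eq_sum, Fin.sum_univ_castSucc, numCutOff_eq_sum]
  simp [addIsolated_reachable_castSucc, not_addIsolated_reachable_last]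

open scoped Classical in
theorem numCutOff_attachLeaf {n : ℕ} (H : SimpleGraph (Fin (n + 1))) (v : Fin (n + 1)) :
    numCutOff (attachLeaf H v) = numCutOff H + if H.Reachable 0 v then 0 else 1 := by
  rw [numCutOff_eq_sum, Fin.sum_univ_castSucc, numCutOff_eq_sum]
  simp [attachLeaf_reachable_castSucc, attachLeaf_reachable_last]

theorem numCutOff_le {n : ℕ} (H : SimpleGraph (Fin (n + 1))) : numCutOff H ≤ n := by
  classical
  rw [numCutOff_eq_sum, Fin.sum_univ_succ]
  simp only [SimpleGraph.Reachable.refl, if_true, zero_add]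
  exact (Finset.sum_le_card_nsmul _ _ 1 (fun i _ => by split_ifs <;> simp)).trans (by simp)

/-! ### The Markov chain of the number of cut-off vertices -/

theorem fromEdgeSet_image_sym2Map {V W : Type*} (f : V ↪ W) (S : Set (Sym2 V)) :
    SimpleGraph.fromEdgeSet (f.sym2Map '' S) = (SimpleGraph.fromEdgeSet S).map f := by
  ext a b
  simp only [SimpleGraph.fromEdgeSet_adj, Set.mem_image, SimpleGraph.map_adj]
  constructor
  · rintro ⟨⟨e, he, h⟩, hab⟩
    induction e with
    | h x y =>
      have hxy : x ≠ y := by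
        rintro rfl
        simp only [Function.Embedding.sym2Map_apply, Sym2.map_mk, Sym2.eq_iff] at h
        rcases h with ⟨h1, h2⟩ | ⟨h1, h2⟩
        · exact hab (h1.symm.trans h2)
        · exact hab (h2.symm.trans h1)
      simp only [Function.Embedding.sym2Map_apply, Sym2.map_mk, Sym2.eq_iff] at h
      rcases h with ⟨h1, h2⟩ | ⟨h1, h2⟩
      · exact ⟨x, y, ⟨he, hxy⟩, h1, h2⟩
      · exact ⟨y, x, ⟨Sym2.eq_swap ▸ he, hxy.symm⟩, h2, h1⟩
  · rintro ⟨x, y, ⟨he, hxy⟩, rfl, rfl⟩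
    exact ⟨⟨_, he, by simp⟩, f.injective.ne hxy⟩

theorem integral_percolatedTreeLaw {E : Type*} [NormedAddCommGroup E] [NormedSpace ℝ E] {n : ℕ}
    (q : unitInterval) (F : SimpleGraph (Fin (n + 1)) → E) :
    ∫ H, F H ∂percolatedTreeLaw n q = ∫ T, ∫ H, F H ∂percolation T q ∂recursiveTreeLaw n := by
  let κ : Kernel (SimpleGraph (Fin (n + 1))) (SimpleGraph (Fin (n + 1))) :=
    ⟨fun T => percolation T q, Measurable.of_discrete⟩
  have h : percolatedTreeLaw n q = (κ ∘ₖ Kernel.const Unit (recursiveTreeLaw n)) () :=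
    Measure.comp_eq_comp_const_apply (μ := recursiveTreeLaw n) (κ := κ)
  rw [h, Kernel.integral_comp (by rw [← h]; exact Integrable.of_finite), Kernel.const_apply]
  rfl

variable {E : Type*} [NormedAddCommGroup E] [NormedSpace ℝ E] [CompleteSpace E]

open scoped Classical in
/-- Percolation on a finite graph as an explicit sum over the sets of retained edges. -/
theorem integral_percolation {V : Type*} [Fintype V] (G : SimpleGraph V) (q : unitInterval)
    (F : SimpleGraph V → E) :
    ∫ H, F H ∂percolation G q = ∑ S ∈ G.edgeFinset.powerset,
      ((q : ℝ) ^ S.card * (1 - q : ℝ) ^ (G.edgeFinset.card - S.card)) •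
        F (SimpleGraph.fromEdgeSet (S : Set (Sym2 V))) := by
  rw [percolation, integral_map SimpleGraph.measurable_fromEdgeSet.aemeasurable
    StronglyMeasurable.of_discrete.aestronglyMeasurable, integral_fintype (Integrable.of_finite)]
  rw [← Equiv.sum_comp Fintype.finsetEquivSet,
    ← Finset.sum_subset (Finset.subset_univ G.edgeFinset.powerset)]
  · refine Finset.sum_congr rfl fun S hS => ?_
    have hsub : (S : Set (Sym2 V)) ⊆ G.edgeSet := by
      rw [← SimpleGraph.coe_edgeFinset]; exact_mod_cast Finset.mem_powerset.1 hS
    rw [Fintype.finsetEquivSet_apply, setBernoulli_real_singleton q hsub (Set.toFinite _),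
      Set.ncard_sdiff' hsub (Set.toFinite _), Set.ncard_coe_finset, ← SimpleGraph.coe_edgeFinset,
      Set.ncard_coe_finset]
  · intro S _ hS
    have hsub : ¬ (S : Set (Sym2 V)) ⊆ G.edgeSet := by
      rw [← SimpleGraph.coe_edgeFinset]
      rw [Finset.mem_powerset] at hS
      exact_mod_cast hS
    rw [Fintype.finsetEquivSet_apply, measureReal_def, setBernoulli_singleton_of_not_subset q hsub]
    simp

/-- Percolation on `attachLeaf G v` amounts to percolation on `G` and an independent decision on the
new edge. -/
theorem integral_percolation_attachLeaf {n : ℕ} (G : SimpleGraph (Fin (n + 1)))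
    (v : Fin (n + 1)) (q : unitInterval) (F : SimpleGraph (Fin (n + 2)) → E) :
    ∫ H, F H ∂percolation (attachLeaf G v) q =
      ∫ H, ((q : ℝ) • F (attachLeaf H v) + (1 - q : ℝ) • F (addIsolated H)) ∂percolation G q := by
  classical
  set φ := (Fin.castSuccEmb (n := n + 1)).sym2Map with hφ
  set e : Sym2 (Fin (n + 2)) := s(v.castSucc, Fin.last (n + 1)) with he
  have hne : v.castSucc ≠ Fin.last (n + 1) := (Fin.castSucc_lt_last v).ne
  have hE : (attachLeaf G v).edgeFinset = insert e (G.edgeFinset.map φ) := by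
    ext x
    have := SimpleGraph.edgeSet_map (Fin.castSuccEmb (n := n + 1)) G
    rw [SimpleGraph.mem_edgeFinset, attachLeaf, SimpleGraph.edgeSet_sup,
      SimpleGraph.edgeSet_edge_of_ne hne, Finset.mem_insert, Finset.mem_map, Set.mem_union, or_comm]
    refine or_congr Iff.rfl ?_
    rw [show Fin.castSucc = ⇑(Fin.castSuccEmb (n := n + 1)) from rfl, this]
    simp [hφ]
  have hemem : ∀ S : Finset (Sym2 (Fin (n + 1))), e ∉ S.map φ := by
    intro S h
    obtain ⟨x, -, hx⟩ := Finset.mem_map.1 h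
    induction x with
    | h x y =>
      simp only [hφ, he, Function.Embedding.sym2Map_apply, Sym2.map_mk, Sym2.eq_iff] at hx
      rcases hx with ⟨-, h2⟩ | ⟨h1, -⟩
      · exact (Fin.castSucc_lt_last y).ne h2
      · exact (Fin.castSucc_lt_last x).ne h1
  have himg : (G.edgeFinset.map φ).powerset = G.edgeFinset.powerset.image (·.map φ) := by
    simp only [Finset.map_eq_image]
    exact Finset.powerset_image
  have hinj : Set.InjOn (fun S : Finset (Sym2 (Fin (n + 1))) => S.map φ) G.edgeFinset.powerset :=
    (Finset.map_injective φ).injOn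
  have hF0 (S : Finset (Sym2 (Fin (n + 1)))) :
      SimpleGraph.fromEdgeSet ((S.map φ : Finset (Sym2 (Fin (n + 2)))) : Set (Sym2 (Fin (n + 2)))) =
        addIsolated (SimpleGraph.fromEdgeSet (S : Set (Sym2 (Fin (n + 1))))) := by
    rw [Finset.coe_map, hφ, fromEdgeSet_image_sym2Map]
    rfl
  have hF1 (S : Finset (Sym2 (Fin (n + 1)))) :
      SimpleGraph.fromEdgeSet
          ((insert e (S.map φ) : Finset (Sym2 (Fin (n + 2)))) : Set (Sym2 (Fin (n + 2)))) =
        attachLeaf (SimpleGraph.fromEdgeSet (S : Set (Sym2 (Fin (n + 1))))) v := by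
    rw [Finset.coe_insert, Set.insert_eq, SimpleGraph.fromEdgeSet_union, hF0, sup_comm]
    rfl
  rw [integral_percolation, hE, Finset.sum_powerset_insert (hemem _), himg,
    Finset.sum_image hinj, Finset.sum_image hinj, integral_percolation, add_comm,
    ← Finset.sum_add_distrib]
  refine Finset.sum_congr rfl fun S hS => ?_
  have hcard := Finset.card_le_card (Finset.mem_powerset.1 hS)
  rw [hF0, hF1, Finset.card_insert_of_notMem (hemem _), Finset.card_insert_of_notMem (hemem _),
    Finset.card_map, Finset.card_map, smul_add, smul_smul, smul_smul, Nat.add_sub_add_right,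
    Nat.sub_add_comm hcard, pow_succ, pow_succ]
  congr 2 <;> ring

open scoped Classical in
theorem integral_recursiveTreeLaw {n : ℕ} (F : SimpleGraph (Fin (n + 1)) → E) :
    ∫ T, F T ∂recursiveTreeLaw n =
      (((Finset.univ.filter fun T : SimpleGraph (Fin (n + 1)) => IsRecursiveTree T).card : ℝ))⁻¹ •
        ∑ T ∈ (Finset.univ.filter fun T : SimpleGraph (Fin (n + 1)) => IsRecursiveTree T), F T := by
  have hset : {T : SimpleGraph (Fin (n + 1)) | IsRecursiveTree T} =
      (Finset.univ.filter fun T : SimpleGraph (Fin (n + 1)) => IsRecursiveTree T) := by simp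
  rw [integral_fintype (Integrable.of_finite), ← Finset.sum_subset (Finset.subset_univ
    (Finset.univ.filter fun T : SimpleGraph (Fin (n + 1)) => IsRecursiveTree T)), Finset.smul_sum]
  · refine Finset.sum_congr rfl fun T hT => ?_
    congr 1
    rw [recursiveTreeLaw, measureReal_def, hset,
      ← Finset.coe_singleton, uniformOn_apply_finset, Finset.inter_singleton_of_mem hT]
    simp
  · intro T _ hT
    rw [recursiveTreeLaw, measureReal_def, hset,
      ← Finset.coe_singleton, uniformOn_apply_finset, Finset.inter_singleton_of_notMem hT]
    simp

/-- A random recursive tree grows by attaching the new vertex to a uniformly chosen old one. -/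
theorem integral_recursiveTreeLaw_succ {n : ℕ} (F : SimpleGraph (Fin (n + 2)) → E) :
    ∫ T, F T ∂recursiveTreeLaw (n + 1) =
      ∫ T, ((n + 1 : ℝ)⁻¹ • ∑ v, F (attachLeaf T v)) ∂recursiveTreeLaw n := by
  classical
  have h : (Finset.univ.filter fun T : SimpleGraph (Fin (n + 2)) => IsRecursiveTree T) =
      ((Finset.univ.filter fun T : SimpleGraph (Fin (n + 1)) => IsRecursiveTree T) ×ˢ
        Finset.univ).image fun x => attachLeaf x.1 x.2 := by
    ext T
    simp only [Finset.mem_filter, true_and, Finset.mem_image, Finset.mem_product,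
      Finset.mem_univ, and_true, Prod.exists]
    constructor
    · intro hT
      obtain ⟨H, v, rfl⟩ := hT.exists_eq_attachLeaf
      exact ⟨H, v, isRecursiveTree_attachLeaf_iff.1 hT, rfl⟩
    · rintro ⟨H, v, hH, rfl⟩
      exact isRecursiveTree_attachLeaf_iff.2 hH
  rw [integral_recursiveTreeLaw, integral_recursiveTreeLaw, h,
    Finset.sum_image attachLeaf_injective.injOn, Finset.sum_product,
    Finset.card_image_of_injective _ attachLeaf_injective, Finset.card_product, ← Finset.smul_sum,
    smul_smul]
  congr 1
  simp [mul_comm]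

theorem integral_percolatedTreeLaw_succ {n : ℕ} (q : unitInterval)
    (F : SimpleGraph (Fin (n + 2)) → E) :
    ∫ H, F H ∂percolatedTreeLaw (n + 1) q =
      ∫ H, ((n + 1 : ℝ)⁻¹ • ∑ v, ((q : ℝ) • F (attachLeaf H v) + (1 - q : ℝ) • F (addIsolated H)))
        ∂percolatedTreeLaw n q := by
  rw [integral_percolatedTreeLaw, integral_recursiveTreeLaw_succ, integral_percolatedTreeLaw]
  congr 1
  ext T
  rw [integral_smul, integral_finsetSum _ (fun _ _ => Integrable.of_finite)]
  simp_rw [integral_percolation_attachLeaf]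

/-- The number of cut-off vertices is a Markov chain. In a tree with `n + 1` vertices, `d` of them
cut off, the new vertex stays connected to the root when its edge is kept, with probability `q`, and
its parent is connected, with probability `(n + 1 - d) / (n + 1)`; otherwise `d` increases by
one. -/
theorem integral_numCutOff_succ {n : ℕ} (q : unitInterval) (f : ℕ → E) :
    ∫ H, f (numCutOff H) ∂percolatedTreeLaw (n + 1) q =
      ∫ H, ((q : ℝ) • (((n + 1 - numCutOff H : ℝ) / (n + 1)) • f (numCutOff H) +
          ((numCutOff H : ℝ) / (n + 1)) • f (numCutOff H + 1)) +
        (1 - q : ℝ) • f (numCutOff H + 1)) ∂percolatedTreeLaw n q := by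
  classical
  rw [integral_percolatedTreeLaw_succ]
  congr 1
  ext H
  have hn : (n + 1 : ℝ) ≠ 0 := by positivity
  have hD : (numCutOff H : ℝ) = ∑ v, if H.Reachable 0 v then 0 else 1 := by
    rw [numCutOff_eq_sum]; push_cast; rfl
  have hC : (n + 1 - numCutOff H : ℝ) = ∑ v, if H.Reachable 0 v then 1 else 0 := by
    rw [sub_eq_iff_eq_add, hD, ← Finset.sum_add_distrib]
    rw [Finset.sum_congr rfl (g := fun _ => (1 : ℝ)) (fun v _ => by split_ifs <;> simp)]
    simp
  have hsum : ∑ v, f (numCutOff (attachLeaf H v)) =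
      (n + 1 - numCutOff H : ℝ) • f (numCutOff H) + (numCutOff H : ℝ) • f (numCutOff H + 1) := by
    rw [hC]
    conv_rhs => rw [hD]
    rw [Finset.sum_smul, Finset.sum_smul, ← Finset.sum_add_distrib]
    refine Finset.sum_congr rfl fun v _ => ?_
    rw [numCutOff_attachLeaf]
    split_ifs <;> simp
  rw [Finset.sum_add_distrib, ← Finset.smul_sum, hsum, smul_add, numCutOff_addIsolated]
  congr 1
  · rw [smul_comm, smul_add, smul_smul, smul_smul, inv_mul_eq_div, inv_mul_eq_div]
  · rw [Finset.sum_const, Finset.card_univ, Fintype.card_fin, ← Nat.cast_smul_eq_nsmul ℝ,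
      smul_smul]
    push_cast
    rw [inv_mul_cancel₀ hn, one_smul]

theorem integral_numCutOff_zero (q : unitInterval) (f : ℕ → E) :
    ∫ H, f (numCutOff H) ∂percolatedTreeLaw 0 q = f 0 := by
  have (H : SimpleGraph (Fin 1)) : numCutOff H = 0 := Nat.le_zero.1 (numCutOff_le H)
  simp [this]

/-! ### An exact multiplicative identity and the first moment -/

/-- The exact identity behind the proof. If `C` of the `N` vertices are connected to the root, then
`h C = ∏ j ∈ [1, C), (1 + r / j)` satisfies `h (C + 1) = h C * (1 + r / C)`; as `C` grows with
probability `q * C / N`, the mean of `h` is multiplied by `1 + r * q / N` at each step. -/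
theorem integral_prod_numCutOff (q : unitInterval) (r : ℂ) (n : ℕ) :
    ∫ H, ∏ j ∈ Finset.Ico 1 (n + 1 - numCutOff H), (1 + r / (j : ℂ)) ∂percolatedTreeLaw n q =
      ∏ j ∈ Finset.Ico 1 (n + 1), (1 + r * (q : ℝ) / (j : ℂ)) := by
  induction n with
  | zero =>
    rw [integral_numCutOff_zero q fun d => ∏ j ∈ Finset.Ico 1 (0 + 1 - d), (1 + r / (j : ℂ))]
    simp
  | succ n ih =>
    rw [integral_numCutOff_succ q fun d => ∏ j ∈ Finset.Ico 1 (n + 1 + 1 - d), (1 + r / (j : ℂ)),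
      Finset.prod_Ico_succ_top (Nat.le_add_left 1 n), ← ih, ← integral_mul_const]
    congr 1
    ext H
    have hD := numCutOff_le H
    have h1 : n + 1 + 1 - (numCutOff H + 1) = n + 1 - numCutOff H := by omega
    have h2 : n + 1 + 1 - numCutOff H = (n + 1 - numCutOff H) + 1 := by omega
    have h3 : ((n + 1 - numCutOff H : ℕ) : ℂ) = n + 1 - numCutOff H := by
      rw [Nat.cast_sub (by omega)]; push_cast; ring
    have h4 : ((n + 1 - numCutOff H : ℕ) : ℂ) ≠ 0 := by
      rw [Nat.cast_ne_zero]; omega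
    rw [h1, h2, Finset.prod_Ico_succ_top (by omega), h3]
    rw [h3] at h4
    have h5 : (n + 1 : ℂ) ≠ 0 := by exact_mod_cast n.succ_ne_zero
    simp only [Complex.real_smul]
    push_cast
    field_simp
    ring

/-- The mean `m` of the number of cut-off vertices satisfies
`m (n + 1) = m n * (1 + q / (n + 1)) + (1 - q)`;
bounding `q` by `1` in the first term makes the harmonic numbers appear. -/
theorem integral_numCutOff_le (q : unitInterval) (n : ℕ) :
    ∫ H, (numCutOff H : ℝ) ∂percolatedTreeLaw n q ≤ (1 - q) * (n + 1) * harmonic (n + 1) := by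
  induction n with
  | zero =>
    rw [integral_numCutOff_zero q fun d => (d : ℝ)]
    have := q.2.2
    simp [harmonic_succ, this]
  | succ n ih =>
    have h5 : (n + 1 : ℝ) ≠ 0 := by positivity
    have h0 := q.2.1
    have h1 := q.2.2
    have key : ∫ H, (numCutOff H : ℝ) ∂percolatedTreeLaw (n + 1) q =
        (∫ H, (numCutOff H : ℝ) ∂percolatedTreeLaw n q) * (1 + q / (n + 1)) + (1 - q) := by
      rw [integral_numCutOff_succ q fun d => (d : ℝ), ← integral_mul_const]
      have : (1 - q : ℝ) = ∫ _, (1 - q : ℝ) ∂percolatedTreeLaw n q := by simp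
      conv_rhs => rw [this]
      rw [← integral_add Integrable.of_finite Integrable.of_finite]
      congr 1
      ext H
      simp only [smul_eq_mul]
      push_cast
      field_simp
      ring
    rw [key, harmonic_succ (n + 1)]
    have hpos : (0 : ℝ) < harmonic (n + 1) := by exact_mod_cast harmonic_pos n.succ_ne_zero
    have hle : (∫ H, (numCutOff H : ℝ) ∂percolatedTreeLaw n q) * (1 + q / (n + 1)) ≤
        ((1 - q) * (n + 1) * harmonic (n + 1)) * (1 + 1 / (n + 1)) := by
      gcongr
    refine (add_le_add_left hle _).trans (le_of_eq ?_)
    push_cast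
    field_simp

theorem one_add_div_ne_zero {r : ℂ} (hr : r.re = 0) (j : ℕ) : 1 + r / (j : ℂ) ≠ 0 := by
  intro h
  have := congrArg Complex.re h
  simp [Complex.div_natCast_re, hr] at this

/-- The identity `integral_prod_numCutOff` divided by the value of its product at full size. For
purely imaginary `r` no factor vanishes and all factors on both sides have modulus at most `1`. -/
theorem integral_prod_inv_numCutOff (q : unitInterval) {r : ℂ} (hr : r.re = 0) (n : ℕ) :
    ∫ H, ∏ j ∈ Finset.Ico (n + 1 - numCutOff H) (n + 1), (1 + r / (j : ℂ))⁻¹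
        ∂percolatedTreeLaw n q =
      ∏ j ∈ Finset.Ico 1 (n + 1), (1 - (1 - (q : ℝ) : ℝ) * r / (j + r)) := by
  have hP : ∏ j ∈ Finset.Ico 1 (n + 1), (1 + r / (j : ℂ)) ≠ 0 :=
    Finset.prod_ne_zero_iff.2 fun j _ => one_add_div_ne_zero hr j
  have h := integral_prod_numCutOff q r n
  rw [← mul_right_inj' hP, ← integral_const_mul]
  convert h using 1
  · congr 1
    ext H
    have hD := numCutOff_le H
    rw [← Finset.prod_Ico_consecutive _ (show 1 ≤ n + 1 - numCutOff H by omega)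
      (Nat.sub_le _ _), mul_assoc, ← Finset.prod_mul_distrib,
      Finset.prod_congr rfl fun j _ => mul_inv_cancel₀ (one_add_div_ne_zero hr j),
      Finset.prod_const_one, mul_one]
  · rw [← Finset.prod_mul_distrib]
    refine Finset.prod_congr rfl fun j hj => ?_
    have hj0 : (j : ℂ) ≠ 0 := Nat.cast_ne_zero.2 (by have := Finset.mem_Ico.1 hj; omega)
    have h1 : (j : ℂ) + r ≠ 0 := by
      have := one_add_div_ne_zero hr j
      intro h
      apply this
      rw [one_add_div hj0, h, zero_div]
    push_cast
    field_simp
    ring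

/-! ### Approximation of the random product by a character -/

theorem norm_prod_sub_prod_le_sum {ι : Type*} (s : Finset ι) (f g : ι → ℂ)
    (hf : ∀ i ∈ s, ‖f i‖ ≤ 1) (hg : ∀ i ∈ s, ‖g i‖ ≤ 1) :
    ‖∏ i ∈ s, f i - ∏ i ∈ s, g i‖ ≤ ∑ i ∈ s, ‖f i - g i‖ := by
  classical
  induction s using Finset.induction_on with
  | empty => simp
  | insert a s ha ih =>
    rw [Finset.prod_insert ha, Finset.prod_insert ha, Finset.sum_insert ha]
    have h1 := hf a (Finset.mem_insert_self a s)
    have h2 : ‖∏ i ∈ s, g i‖ ≤ 1 := by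
      rw [norm_prod]
      exact Finset.prod_le_one (fun _ _ => norm_nonneg _)
        fun i hi => hg i (Finset.mem_insert_of_mem hi)
    have h3 := ih (fun i hi => hf i (Finset.mem_insert_of_mem hi))
      (fun i hi => hg i (Finset.mem_insert_of_mem hi))
    calc ‖f a * ∏ i ∈ s, f i - g a * ∏ i ∈ s, g i‖
        = ‖f a * (∏ i ∈ s, f i - ∏ i ∈ s, g i) + (f a - g a) * ∏ i ∈ s, g i‖ := by ring_nf
      _ ≤ ‖f a‖ * ‖∏ i ∈ s, f i - ∏ i ∈ s, g i‖ + ‖f a - g a‖ * ‖∏ i ∈ s, g i‖ := by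
        rw [← norm_mul, ← norm_mul]; exact norm_add_le _ _
      _ ≤ 1 * ‖∏ i ∈ s, f i - ∏ i ∈ s, g i‖ + ‖f a - g a‖ * 1 := by gcongr
      _ ≤ _ := by linarith

theorem one_le_norm_one_add_I_mul (x : ℝ) : 1 ≤ ‖1 + Complex.I * x‖ := by
  have := Complex.abs_re_le_norm (1 + Complex.I * x)
  simpa using this

theorem norm_exp_I_mul (x : ℝ) : ‖Complex.exp (Complex.I * x)‖ = 1 := by
  rw [mul_comm, Complex.norm_exp_ofReal_mul_I]

theorem norm_inv_one_add_I_mul_sub_exp_le (x : ℝ) :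
    ‖(1 + Complex.I * x)⁻¹ - Complex.exp (-(Complex.I * x))‖ ≤ 3 * x ^ 2 := by
  have h1 := one_le_norm_one_add_I_mul x
  have h0 : 1 + Complex.I * x ≠ 0 := norm_pos_iff.1 (by linarith)
  have hnorm : ‖Complex.I * (x : ℂ)‖ = |x| := by simp
  have h2 : ‖Complex.exp (Complex.I * x) - 1 - Complex.I * x‖ ≤ 3 * x ^ 2 := by
    rcases le_total |x| 1 with hx | hx
    · refine (Complex.norm_exp_sub_one_sub_id_le (hnorm ▸ hx)).trans ?_
      rw [hnorm, sq_abs]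
      nlinarith [sq_nonneg x]
    · refine (norm_sub_le _ _).trans ?_
      refine (add_le_add (norm_sub_le _ _) le_rfl).trans ?_
      rw [norm_exp_I_mul, hnorm, norm_one, ← sq_abs]
      nlinarith
  have h3 : (1 + Complex.I * x)⁻¹ - Complex.exp (-(Complex.I * x)) =
      (Complex.exp (Complex.I * x) - 1 - Complex.I * x) *
        ((1 + Complex.I * x)⁻¹ * Complex.exp (-(Complex.I * x))) := by
    rw [Complex.exp_neg]
    have := Complex.exp_ne_zero (Complex.I * x)
    field_simp
    ring
  have h4 : ‖Complex.exp (-(Complex.I * x))‖ = 1 := by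
    rw [Complex.exp_neg, norm_inv, norm_exp_I_mul, inv_one]
  rw [h3, norm_mul, norm_mul, h4, mul_one, norm_inv]
  calc _ ≤ ‖Complex.exp (Complex.I * x) - 1 - Complex.I * x‖ * 1 := by
        gcongr
        exact inv_le_one_of_one_le₀ h1
    _ ≤ _ := by rwa [mul_one]

theorem norm_exp_neg_I_mul_sub_le (x y : ℝ) :
    ‖Complex.exp (-(Complex.I * x)) - Complex.exp (-(Complex.I * y))‖ ≤ |x - y| := by
  have h : Complex.exp (-(Complex.I * x)) - Complex.exp (-(Complex.I * y)) =
      Complex.exp (Complex.I * ((-y : ℝ) : ℂ)) *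
        (Complex.exp (Complex.I * ((y - x : ℝ) : ℂ)) - 1) := by
    rw [mul_sub, ← Complex.exp_add, mul_one]
    push_cast
    ring_nf
  rw [h, norm_mul, norm_exp_I_mul, one_mul, abs_sub_comm]
  exact Real.norm_exp_I_mul_ofReal_sub_one_le

/-- The product in `integral_prod_inv_numCutOff` is close to a character of `D`, with an error
linear in `D`, so that only the first moment of the number of cut-off vertices is needed. -/
theorem norm_prod_inv_sub_exp_le (ρ : ℝ) {N D : ℕ} (hD : D < N) :
    ‖∏ j ∈ Finset.Ico (N - D) N, (1 + Complex.I * ρ / (j : ℂ))⁻¹ -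
        Complex.exp (-(Complex.I * (ρ * D / N : ℝ)))‖ ≤
      D * (12 * ρ ^ 2 / N ^ 2 + 2 * √|ρ| / N + 4 / N) := by
  have hN : (0 : ℝ) < N := by exact_mod_cast lt_of_le_of_lt (Nat.zero_le D) hD
  have hfac (j : ℕ) : Complex.I * ρ / (j : ℂ) = Complex.I * ((ρ / j : ℝ) : ℂ) := by
    push_cast; ring
  have hf : ∀ j ∈ Finset.Ico (N - D) N, ‖(1 + Complex.I * ρ / (j : ℂ))⁻¹‖ ≤ 1 := by
    intro j _
    rw [hfac, norm_inv]
    exact inv_le_one_of_one_le₀ (one_le_norm_one_add_I_mul _)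
  have hexp (x : ℝ) : ‖Complex.exp (-(Complex.I * x))‖ = 1 := by
    rw [Complex.exp_neg, norm_inv, norm_exp_I_mul, inv_one]
  have htriv : ‖∏ j ∈ Finset.Ico (N - D) N, (1 + Complex.I * ρ / (j : ℂ))⁻¹ -
        Complex.exp (-(Complex.I * (ρ * D / N : ℝ)))‖ ≤ 2 := by
    refine (norm_sub_le _ _).trans ?_
    rw [hexp, norm_prod]
    have := Finset.prod_le_one (fun j _ => norm_nonneg _) hf
    linarith
  rcases le_or_gt (N : ℝ) (2 * D) with hcase | hcase
  · refine htriv.trans ?_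
    have h1 : 2 ≤ (D : ℝ) * (4 / N) := by
      rw [← mul_div_assoc, le_div_iff₀ hN]; linarith
    have h2 : 0 ≤ (D : ℝ) * (12 * ρ ^ 2 / N ^ 2 + 2 * √|ρ| / N) := by positivity
    linarith
  -- for `D < N / 2` every index `j` of the product exceeds `N / 2`
  have hj : ∀ j ∈ Finset.Ico (N - D) N, (N : ℝ) / 2 ≤ j ∧ (j : ℝ) ≤ N ∧ (N : ℝ) - j ≤ D := by
    intro j hj
    obtain ⟨h1, h2⟩ := Finset.mem_Ico.1 hj
    have h3 : (N : ℝ) ≤ j + D := by exact_mod_cast (by omega : N ≤ j + D)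
    have h4 : (j : ℝ) ≤ N := by exact_mod_cast h2.le
    exact ⟨by linarith, h4, by linarith⟩
  have hcard : (Finset.Ico (N - D) N).card = D := by rw [Nat.card_Ico]; omega
  have hprod : ∏ j ∈ Finset.Ico (N - D) N, Complex.exp (-(Complex.I * ((ρ / j : ℝ) : ℂ))) =
      Complex.exp (-(Complex.I * ((∑ j ∈ Finset.Ico (N - D) N, ρ / j : ℝ) : ℂ))) := by
    rw [← Complex.exp_sum, Finset.sum_neg_distrib, ← Finset.mul_sum]
    push_cast
    rfl
  have hA : ‖∏ j ∈ Finset.Ico (N - D) N, (1 + Complex.I * ρ / (j : ℂ))⁻¹ -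
      Complex.exp (-(Complex.I * ((∑ j ∈ Finset.Ico (N - D) N, ρ / j : ℝ) : ℂ)))‖ ≤
        D * (12 * ρ ^ 2 / N ^ 2) := by
    rw [← hprod]
    refine (norm_prod_sub_prod_le_sum _ _ _ hf fun j _ => (hexp _).le).trans ?_
    refine (Finset.sum_le_card_nsmul _ _ (12 * ρ ^ 2 / N ^ 2) fun j hjm => ?_).trans
      (by rw [hcard, nsmul_eq_mul])
    rw [hfac]
    refine (norm_inv_one_add_I_mul_sub_exp_le _).trans ?_
    obtain ⟨h1, -, -⟩ := hj j hjm
    calc 3 * (ρ / j) ^ 2 = 3 * ρ ^ 2 / (j : ℝ) ^ 2 := by ring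
      _ ≤ 3 * ρ ^ 2 / ((N : ℝ) / 2) ^ 2 := by gcongr
      _ = 12 * ρ ^ 2 / N ^ 2 := by field_simp; ring
  have hsum : |∑ j ∈ Finset.Ico (N - D) N, ρ / (j : ℝ) - ρ * D / N| ≤
      2 * |ρ| * D ^ 2 / N ^ 2 := by
    have : ρ * D / N = ∑ j ∈ Finset.Ico (N - D) N, ρ / (N : ℝ) := by
      rw [Finset.sum_const, hcard, nsmul_eq_mul]; ring
    rw [this, ← Finset.sum_sub_distrib]
    refine (Finset.abs_sum_le_sum_abs _ _).trans ?_
    refine (Finset.sum_le_card_nsmul _ _ (2 * |ρ| * D / N ^ 2) fun j hjm => ?_).trans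
      (le_of_eq (by rw [hcard, nsmul_eq_mul]; ring))
    obtain ⟨h1, h2, h3⟩ := hj j hjm
    have hjpos : (0 : ℝ) < j := by linarith
    rw [show ρ / (j : ℝ) - ρ / N = ρ * ((N - j) / (j * N)) by field_simp, abs_mul,
      abs_of_nonneg (show (0 : ℝ) ≤ (N - j) / (j * N) from
        div_nonneg (by linarith) (by positivity))]
    calc |ρ| * ((N - j) / (j * N)) ≤ |ρ| * (D / (N / 2 * N)) := by gcongr
      _ = 2 * |ρ| * D / N ^ 2 := by field_simp
  -- `min 2 (2 s ^ 2) ≤ 2 s` turns the quadratic error into one that is linear in `D`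
  have hB : ‖Complex.exp (-(Complex.I * ((∑ j ∈ Finset.Ico (N - D) N, ρ / j : ℝ) : ℂ))) -
      Complex.exp (-(Complex.I * (ρ * D / N : ℝ)))‖ ≤ D * (2 * √|ρ| / N) := by
    have h1 := (norm_exp_neg_I_mul_sub_le (∑ j ∈ Finset.Ico (N - D) N, ρ / j) (ρ * D / N)).trans
      hsum
    set s := D * √|ρ| / N with hs
    have hs0 : 0 ≤ s := by positivity
    have hs2 : 2 * |ρ| * D ^ 2 / N ^ 2 = 2 * s ^ 2 := by
      rw [hs, div_pow, mul_pow, Real.sq_sqrt (abs_nonneg ρ)]; ring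
    have hgoal : (D : ℝ) * (2 * √|ρ| / N) = 2 * s := by rw [hs]; ring
    rw [hgoal]
    rcases le_total s 1 with h | h
    · rw [hs2] at h1
      refine h1.trans ?_
      nlinarith
    · refine (norm_sub_le _ _).trans ?_
      rw [hexp, hexp]
      linarith
  calc _ ≤ D * (12 * ρ ^ 2 / N ^ 2) + D * (2 * √|ρ| / N) :=
        (norm_sub_le_norm_sub_add_norm_sub _ _ _).trans (add_le_add hA hB)
    _ ≤ _ := by
      have : 0 ≤ (D : ℝ) * (4 / N) := by positivity
      linarith

/-- In mean, the product in `integral_prod_inv_numCutOff` is close to the characteristic function of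
the number of cut-off vertices at `-ρ / (n + 1)`. -/
theorem norm_integral_sub_le (q : unitInterval) (ρ : ℝ) (n : ℕ) :
    ‖∫ H, ∏ j ∈ Finset.Ico (n + 1 - numCutOff H) (n + 1), (1 + Complex.I * ρ / (j : ℂ))⁻¹
          ∂percolatedTreeLaw n q -
        ∫ H, Complex.exp (-(Complex.I * (ρ * numCutOff H / (n + 1 : ℕ) : ℝ)))
          ∂percolatedTreeLaw n q‖ ≤
      (1 - q) * (1 + Real.log (n + 1 : ℕ)) *
        (12 * ρ ^ 2 / (n + 1 : ℕ) + 2 * √|ρ| + 4) := by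
  have hN : (0 : ℝ) < (n + 1 : ℕ) := by positivity
  rw [← integral_sub Integrable.of_finite Integrable.of_finite]
  refine (norm_integral_le_integral_norm _).trans ?_
  refine (integral_mono Integrable.of_finite Integrable.of_finite fun H =>
    norm_prod_inv_sub_exp_le ρ (Nat.lt_succ_of_le (numCutOff_le H))).trans ?_
  rw [integral_mul_const]
  have h1 := integral_numCutOff_le q n
  have h2 := harmonic_le_one_add_log (n + 1)
  have hq : (0 : ℝ) ≤ 1 - q := by have := q.2.2; linarith
  refine (mul_le_mul_of_nonneg_right (h1.trans (mul_le_mul_of_nonneg_left h2 (by positivity)))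
    (by positivity)).trans (le_of_eq ?_)
  push_cast
  field_simp

/-! ### The explicit product as the exponential of a logarithm -/

theorem sum_Ico_inv_le_one_add_log (k : ℕ) :
    ∑ j ∈ Finset.Ico 1 k, (j : ℝ)⁻¹ ≤ 1 + Real.log k := by
  refine le_trans ?_ (harmonic_le_one_add_log k)
  rw [harmonic_eq_sum_Icc]
  push_cast
  exact Finset.sum_le_sum_of_subset_of_nonneg
    (fun x hx => by simp only [Finset.mem_Ico, Finset.mem_Icc] at *; omega)
    fun _ _ _ => by positivity

theorem sq_norm_natCast_add_I_mul (j : ℕ) (ρ : ℝ) :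
    ‖(j : ℂ) + Complex.I * ρ‖ ^ 2 = (j : ℝ) ^ 2 + ρ ^ 2 := by
  rw [Complex.sq_norm, Complex.normSq_apply]
  simp
  ring

theorem sum_inv_sq_norm_le {ρ : ℝ} (hρ : ρ ≠ 0) (k : ℕ) :
    ∑ j ∈ Finset.Ico 1 k, (‖(j : ℂ) + Complex.I * ρ‖ ^ 2)⁻¹ ≤ (1 + Real.log k) / |ρ| := by
  have hρ' := abs_pos.2 hρ
  refine le_trans ?_ (div_le_div_of_nonneg_right (sum_Ico_inv_le_one_add_log k) hρ'.le)
  rw [Finset.sum_div]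
  -- `2 * j * |ρ| ≤ j ^ 2 + ρ ^ 2` reduces the sum to a harmonic one
  refine Finset.sum_le_sum fun j hj => ?_
  have hj1 : (0 : ℝ) < j := by exact_mod_cast (Finset.mem_Ico.1 hj).1
  rw [sq_norm_natCast_add_I_mul, div_eq_mul_inv, ← mul_inv, ← one_div, ← one_div]
  refine one_div_le_one_div_of_le (by positivity) ?_
  rw [← sq_abs ρ]
  nlinarith [sq_nonneg ((j : ℝ) - |ρ|), mul_pos hj1 hρ']

/-- The explicit side of `integral_prod_inv_numCutOff` is close to the exponential of a sum. -/
theorem norm_prod_one_sub_sub_exp_le {ε : ℝ} (h0 : 0 ≤ ε) (h1 : ε ≤ 1) {ρ : ℝ} (hρ : ρ ≠ 0)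
    (k : ℕ) :
    ‖∏ j ∈ Finset.Ico 1 k, (1 - ε * (Complex.I * ρ) / ((j : ℂ) + Complex.I * ρ)) -
        Complex.exp (-(ε * (Complex.I * ρ) * ∑ j ∈ Finset.Ico 1 k, ((j : ℂ) + Complex.I * ρ)⁻¹))‖ ≤
      ε ^ 2 * |ρ| * (1 + Real.log k) := by
  have hρ' := abs_pos.2 hρ
  have hne (j : ℕ) : (j : ℂ) + Complex.I * ρ ≠ 0 := by
    intro h
    have := congrArg Complex.im h
    simp [hρ] at this
  have hnle (j : ℕ) : |ρ| ≤ ‖(j : ℂ) + Complex.I * ρ‖ := by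
    have := Complex.abs_im_le_norm ((j : ℂ) + Complex.I * ρ)
    simpa using this
  have hu (j : ℕ) : ‖ε * (Complex.I * ρ) / ((j : ℂ) + Complex.I * ρ)‖ =
      ε * |ρ| / ‖(j : ℂ) + Complex.I * ρ‖ := by
    simp [abs_of_nonneg h0]
  -- the factor equals `(j + i (1 - ε) ρ) / (j + i ρ)`
  have hf (j : ℕ) : ‖1 - ε * (Complex.I * ρ) / ((j : ℂ) + Complex.I * ρ)‖ ≤ 1 := by
    have h : 1 - ε * (Complex.I * ρ) / ((j : ℂ) + Complex.I * ρ) =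
        ((j : ℂ) + Complex.I * ((1 - ε) * ρ : ℝ)) / ((j : ℂ) + Complex.I * ρ) := by
      rw [eq_div_iff (hne j), sub_mul, div_mul_cancel₀ _ (hne j)]
      push_cast
      ring
    rw [h, norm_div]
    refine div_le_one_of_le₀ ?_ (norm_nonneg _)
    refine (sq_le_sq₀ (norm_nonneg _) (norm_nonneg _)).1 ?_
    rw [sq_norm_natCast_add_I_mul, sq_norm_natCast_add_I_mul]
    have : (1 - ε) ^ 2 ≤ 1 := by nlinarith
    nlinarith [sq_nonneg ρ]
  have hre (j : ℕ) : 0 ≤ (ε * (Complex.I * ρ) / ((j : ℂ) + Complex.I * ρ)).re := by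
    rw [Complex.div_re]
    simp
    have : 0 ≤ ε * ρ * ρ := by nlinarith [mul_self_nonneg ρ]
    exact div_nonneg this (Complex.normSq_nonneg _)
  have hg (j : ℕ) : ‖Complex.exp (-(ε * (Complex.I * ρ) / ((j : ℂ) + Complex.I * ρ)))‖ ≤ 1 := by
    rw [Complex.norm_exp, Complex.neg_re]
    exact Real.exp_le_one_iff.2 (neg_nonpos.2 (hre j))
  have hprod : Complex.exp (-(ε * (Complex.I * ρ) *
      ∑ j ∈ Finset.Ico 1 k, ((j : ℂ) + Complex.I * ρ)⁻¹)) =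
      ∏ j ∈ Finset.Ico 1 k, Complex.exp (-(ε * (Complex.I * ρ) / ((j : ℂ) + Complex.I * ρ))) := by
    rw [← Complex.exp_sum, Finset.sum_neg_distrib, Finset.mul_sum]
    rfl
  rw [hprod]
  refine (norm_prod_sub_prod_le_sum _ _ _ (fun j _ => hf j) fun j _ => hg j).trans ?_
  calc _ ≤ ∑ j ∈ Finset.Ico 1 k, ε ^ 2 * |ρ| ^ 2 * (‖(j : ℂ) + Complex.I * ρ‖ ^ 2)⁻¹ := by
        refine Finset.sum_le_sum fun j _ => ?_
        have hle : ‖-(ε * (Complex.I * ρ) / ((j : ℂ) + Complex.I * ρ))‖ ≤ 1 := by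
          rw [norm_neg, hu]
          refine div_le_one_of_le₀ ?_ (norm_nonneg _)
          nlinarith [hnle j]
        have h := Complex.norm_exp_sub_one_sub_id_le hle
        rw [norm_neg, hu] at h
        rw [norm_sub_rev]
        refine le_trans (le_of_eq ?_) (h.trans (le_of_eq ?_))
        · congr 1; ring
        · rw [div_pow, mul_pow, div_eq_mul_inv]
    _ ≤ ε ^ 2 * |ρ| ^ 2 * ((1 + Real.log k) / |ρ|) := by
        rw [← Finset.mul_sum]
        exact mul_le_mul_of_nonneg_left (sum_inv_sq_norm_le hρ k) (by positivity)
    _ = _ := by field_simp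

theorem log_add_one_sub_log {z : ℂ} (hz : 0 < z.re) :
    Complex.log (z + 1) - Complex.log z = Complex.log (1 + z⁻¹) := by
  have hz0 : z ≠ 0 := by rintro rfl; simp at hz
  have hinv : 0 < (1 + z⁻¹).re := by
    rw [Complex.add_re, Complex.one_re, Complex.inv_re]
    have := Complex.normSq_pos.2 hz0
    positivity
  have h1 : 1 + z⁻¹ ≠ 0 := by intro h; rw [h] at hinv; simp at hinv
  have ha := abs_lt.1 (Complex.abs_arg_lt_pi_div_two_iff.2 (.inl hz))
  have hb := abs_lt.1 (Complex.abs_arg_lt_pi_div_two_iff.2 (.inl hinv))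
  have h := Complex.log_mul hz0 h1 ⟨by linarith [ha.1, hb.1], by linarith [ha.2, hb.2]⟩
  rw [mul_add, mul_one, mul_inv_cancel₀ hz0] at h
  rw [h]
  ring

theorem norm_sum_inv_sub_log_le {ρ : ℝ} (hρ : 2 ≤ |ρ|) {k : ℕ} (hk : 1 ≤ k) :
    ‖∑ j ∈ Finset.Ico 1 k, ((j : ℂ) + Complex.I * ρ)⁻¹ -
        (Complex.log (k + Complex.I * ρ) - Complex.log (1 + Complex.I * ρ))‖ ≤
      (1 + Real.log k) / |ρ| := by
  have hρ0 : ρ ≠ 0 := by rintro rfl; simp at hρ; linarith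
  have htel : Complex.log (k + Complex.I * ρ) - Complex.log (1 + Complex.I * ρ) =
      ∑ j ∈ Finset.Ico 1 k, Complex.log (1 + ((j : ℂ) + Complex.I * ρ)⁻¹) := by
    have := Finset.sum_Ico_sub (fun j : ℕ => Complex.log ((j : ℂ) + Complex.I * ρ)) hk
    simp only [Nat.cast_one] at this
    rw [← this]
    refine Finset.sum_congr rfl fun j hj => ?_
    rw [← log_add_one_sub_log]
    · push_cast; congr 2; ring
    · have := (Finset.mem_Ico.1 hj).1
      simpa using (show 0 < j by omega)
  rw [htel, ← Finset.sum_sub_distrib]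
  refine (norm_sum_le _ _).trans (le_trans (Finset.sum_le_sum fun j _ => ?_)
    (sum_inv_sq_norm_le hρ0 k))
  have hnle : |ρ| ≤ ‖(j : ℂ) + Complex.I * ρ‖ := by
    have := Complex.abs_im_le_norm ((j : ℂ) + Complex.I * ρ)
    simpa using this
  have hhalf : ‖((j : ℂ) + Complex.I * ρ)⁻¹‖ ≤ 1 / 2 := by
    rw [norm_inv, ← one_div]
    exact one_div_le_one_div_of_le (by norm_num) (hρ.trans hnle)
  rw [norm_sub_rev]
  refine (Complex.norm_log_one_add_sub_self_le (hhalf.trans_lt (by norm_num))).trans ?_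
  have h2 : (1 - ‖((j : ℂ) + Complex.I * ρ)⁻¹‖)⁻¹ ≤ 2 := by
    rw [← one_div, div_le_iff₀ (by linarith)]; linarith
  rw [← inv_pow, ← norm_inv]
  nlinarith [sq_nonneg ‖((j : ℂ) + Complex.I * ρ)⁻¹‖]

/-! ### Convergence of the characteristic functions -/

open Topology

theorem tendsto_rpow_neg_mul_one_add_log {s : ℝ} (hs : 0 < s) :
    Tendsto (fun k : ℕ => (k : ℝ) ^ (-s) * (1 + Real.log k)) atTop (𝓝 0) := by
  have h1 : Tendsto (fun x : ℝ => x ^ (-s) * (1 + Real.log x)) atTop (𝓝 0) := by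
    have h2 := (isLittleO_log_rpow_atTop hs).tendsto_div_nhds_zero
    have h3 := tendsto_rpow_neg_atTop hs
    have := h3.add h2
    rw [add_zero] at this
    refine this.congr' ?_
    filter_upwards [eventually_gt_atTop 0] with x hx
    rw [Real.rpow_neg hx.le]
    ring
  exact h1.comp tendsto_natCast_atTop_atTop

section rates

variable {c : ℝ} {ε : ℕ → ℝ}

theorem tendsto_mul_rpow (hε : Tendsto (fun k : ℕ => (ε k * (k : ℝ) ^ (1 / 4 : ℝ) - c) * Real.log k)
    atTop (𝓝 0)) : Tendsto (fun k : ℕ => ε k * (k : ℝ) ^ (1 / 4 : ℝ)) atTop (𝓝 c) := by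
  have hlog : Tendsto (fun k : ℕ => Real.log k) atTop atTop :=
    Real.tendsto_log_atTop.comp tendsto_natCast_atTop_atTop
  have h := (hε.mul (tendsto_inv_atTop_zero.comp hlog)).add_const c
  rw [mul_zero, zero_add] at h
  refine h.congr' ?_
  filter_upwards [hlog.eventually_gt_atTop 0] with k hk
  simp only [Function.comp_apply]
  rw [mul_assoc, mul_inv_cancel₀ hk.ne']
  ring

theorem eq_mul_rpow_neg {k : ℕ} (hk : 1 ≤ k) (x : ℝ) :
    x = x * (k : ℝ) ^ (1 / 4 : ℝ) * (k : ℝ) ^ (-(1 / 4) : ℝ) := by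
  have : (0 : ℝ) < k := by exact_mod_cast hk
  rw [mul_assoc, ← Real.rpow_add this]
  simp

theorem tendsto_mul_one_add_log
    (ha : Tendsto (fun k : ℕ => ε k * (k : ℝ) ^ (1 / 4 : ℝ)) atTop (𝓝 c)) :
    Tendsto (fun k : ℕ => ε k * (1 + Real.log k)) atTop (𝓝 0) := by
  have h := ha.mul (tendsto_rpow_neg_mul_one_add_log (s := 1 / 4) (by norm_num))
  rw [mul_zero] at h
  refine h.congr' ?_
  filter_upwards [eventually_ge_atTop 1] with k hk
  rw [← mul_assoc, ← eq_mul_rpow_neg hk]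

/-- The bound of `norm_integral_sub_le` vanishes in the limit: for `ρ = -θ k ^ (1 / 4)` it is of
order `k ^ (-1 / 8) * log k`. -/
theorem tendsto_integral_error (θ : ℝ)
    (ha : Tendsto (fun k : ℕ => ε k * (k : ℝ) ^ (1 / 4 : ℝ)) atTop (𝓝 c)) :
    Tendsto (fun k : ℕ => ε k * (1 + Real.log k) *
      (12 * (-(θ * (k : ℝ) ^ (1 / 4 : ℝ))) ^ 2 / k + 2 * √|-(θ * (k : ℝ) ^ (1 / 4 : ℝ))| + 4))
      atTop (𝓝 0) := by
  have hp (s : ℝ) (hs : 0 < s) : Tendsto (fun k : ℕ => (k : ℝ) ^ (-s)) atTop (𝓝 0) :=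
    (tendsto_rpow_neg_atTop hs).comp tendsto_natCast_atTop_atTop
  have h1 := tendsto_rpow_neg_mul_one_add_log (s := 1 / 8) (by norm_num)
  have h2 := (((hp (5 / 8) (by norm_num)).const_mul (12 * θ ^ 2)).add
    (((hp (1 / 8) (by norm_num)).const_mul 4))).add_const (2 * √|θ|)
  have h := (ha.mul h1).mul h2
  rw [mul_zero, zero_mul] at h
  refine h.congr' ?_
  filter_upwards [eventually_ge_atTop 1] with k hk
  have hk0 : (0 : ℝ) < k := by exact_mod_cast hk
  -- all the powers of `k` involved are powers of `k ^ (1 / 8)`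
  set y := (k : ℝ) ^ (1 / 8 : ℝ) with hy
  have hy0 : 0 < y := Real.rpow_pos_of_pos hk0 _
  have hpow (m : ℕ) (s : ℝ) (hs : s = m / 8) : (k : ℝ) ^ s = y ^ m := by
    rw [hy, ← Real.rpow_natCast, ← Real.rpow_mul hk0.le, hs]; congr 1; ring
  have e1 : (k : ℝ) ^ (1 / 4 : ℝ) = y ^ 2 := hpow 2 _ (by norm_num)
  have e2 : (k : ℝ) ^ (-(1 / 8) : ℝ) = y⁻¹ := by rw [Real.rpow_neg hk0.le]
  have e3 : (k : ℝ) ^ (-(5 / 8) : ℝ) = (y ^ 5)⁻¹ := by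
    rw [Real.rpow_neg hk0.le, hpow 5 _ (by norm_num)]
  have e4 : (k : ℝ) = y ^ 8 := by rw [← hpow 8 1 (by norm_num), Real.rpow_one]
  have e5 : √|-(θ * y ^ 2)| = √|θ| * y := by
    rw [abs_neg, abs_mul, Real.sqrt_mul (abs_nonneg _), abs_of_nonneg (sq_nonneg y),
      Real.sqrt_sq hy0.le]
  rw [e1, e2, e3, e5]
  generalize Real.log k = l
  rw [e4]
  field_simp
  ring

end rates

theorem log_neg_I_mul_sign {θ : ℝ} (hθ : θ ≠ 0) :
    (θ : ℂ) * Complex.log (-(Complex.I * (θ / |θ| : ℝ))) =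
      -(Complex.I * (Real.pi / 2 * |θ| : ℝ)) := by
  rcases lt_or_gt_of_ne hθ with h | h
  · rw [abs_of_neg h, div_neg, div_self hθ]
    have : -(Complex.I * ((-1 : ℝ) : ℂ)) = Complex.I := by push_cast; ring
    rw [this, Complex.log_I]
    push_cast
    ring
  · rw [abs_of_pos h, div_self hθ]
    have : -(Complex.I * ((1 : ℝ) : ℂ)) = -Complex.I := by push_cast; ring
    rw [this, Complex.log_neg_I]
    push_cast
    ring

/-- The exponent that produces the Luria-Delbrück law. With `ρ = -θ k ^ (1 / 4)` and
`a = ε k ^ (1 / 4) → c`, it equals `i θ a (log (k + i ρ) - log (1 + i ρ))` up to the centring; the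
first logarithm is about `log k`, the second about `log |θ| + log k / 4 - i (π / 2) sign θ`, whence
the centring constant `3 / 4` and the two terms of the limit. -/
theorem tendsto_log_exponent {c θ : ℝ} (hθ : θ ≠ 0) {ε : ℕ → ℝ}
    (hε : Tendsto (fun k : ℕ => (ε k * (k : ℝ) ^ (1 / 4 : ℝ) - c) * Real.log k) atTop (𝓝 0)) :
    Tendsto (fun k : ℕ => -(ε k * (Complex.I * (-(θ * (k : ℝ) ^ (1 / 4 : ℝ)) : ℝ)) *
        (Complex.log (k + Complex.I * (-(θ * (k : ℝ) ^ (1 / 4 : ℝ)) : ℝ)) -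
          Complex.log (1 + Complex.I * (-(θ * (k : ℝ) ^ (1 / 4 : ℝ)) : ℝ)))) -
        Complex.I * (3 / 4 * c * Real.log k * θ : ℝ)) atTop
      (𝓝 (-((c * (Real.pi / 2 * |θ|) : ℝ) : ℂ) - Complex.I * (c * (θ * Real.log |θ|) : ℝ))) := by
  have ha := tendsto_mul_rpow hε
  have hk1 : Tendsto (fun k : ℕ => θ * (k : ℝ) ^ (-(3 / 4) : ℝ)) atTop (𝓝 0) := by
    have := ((tendsto_rpow_neg_atTop (y := 3 / 4) (by norm_num)).comp
      tendsto_natCast_atTop_atTop).const_mul θ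
    simpa using this
  have hk2 : Tendsto (fun k : ℕ => (|θ| * (k : ℝ) ^ (1 / 4 : ℝ))⁻¹) atTop (𝓝 0) := by
    refine tendsto_inv_atTop_zero.comp (Tendsto.const_mul_atTop (abs_pos.2 hθ) ?_)
    exact (tendsto_rpow_atTop (by norm_num)).comp tendsto_natCast_atTop_atTop
  have hl1 : Tendsto (fun k : ℕ =>
      Complex.log (1 + Complex.I * (-(θ * (k : ℝ) ^ (-(3 / 4) : ℝ)) : ℝ))) atTop (𝓝 0) := by
    have h1 : Tendsto (fun x : ℝ => Complex.log (1 + Complex.I * ((-x : ℝ) : ℂ))) (𝓝 0)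
        (𝓝 (Complex.log (1 + Complex.I * ((-0 : ℝ) : ℂ)))) := by
      refine ContinuousAt.clog (by fun_prop) (by simp)
    simp only [neg_zero, Complex.ofReal_zero, mul_zero, add_zero, Complex.log_one] at h1
    exact h1.comp hk1
  have hl2 : Tendsto (fun k : ℕ => Complex.log (((|θ| * (k : ℝ) ^ (1 / 4 : ℝ))⁻¹ : ℝ) -
      Complex.I * (θ / |θ| : ℝ))) atTop (𝓝 (Complex.log (-(Complex.I * (θ / |θ| : ℝ))))) := by
    have h1 : Tendsto (fun x : ℝ => Complex.log ((x : ℂ) - Complex.I * (θ / |θ| : ℝ))) (𝓝 0)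
        (𝓝 (Complex.log (((0 : ℝ) : ℂ) - Complex.I * (θ / |θ| : ℝ)))) := by
      refine ContinuousAt.clog (by fun_prop) (Or.inr ?_)
      simp [hθ]
    rw [Complex.ofReal_zero, zero_sub] at h1
    exact h1.comp hk2
  have haC : Tendsto (fun k : ℕ => ((ε k * (k : ℝ) ^ (1 / 4 : ℝ) : ℝ) : ℂ)) atTop (𝓝 (c : ℂ)) :=
    (Complex.continuous_ofReal.tendsto c).comp ha
  have hεC : Tendsto (fun k : ℕ =>
      (((ε k * (k : ℝ) ^ (1 / 4 : ℝ) - c) * Real.log k : ℝ) : ℂ)) atTop (𝓝 0) := by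
    have := (Complex.continuous_ofReal.tendsto 0).comp hε
    rwa [Complex.ofReal_zero] at this
  have hlim := ((hεC.const_mul (3 / 4 : ℂ)).add (haC.mul ((hl1.sub_const
    ((Real.log |θ| : ℝ) : ℂ)).sub hl2))).const_mul (Complex.I * θ)
  have hval : Complex.I * θ * (3 / 4 * 0 + c * (0 - ((Real.log |θ| : ℝ) : ℂ) -
      Complex.log (-(Complex.I * (θ / |θ| : ℝ))))) =
      -((c * (Real.pi / 2 * |θ|) : ℝ) : ℂ) - Complex.I * (c * (θ * Real.log |θ|) : ℝ) := by
    have h1 := log_neg_I_mul_sign hθ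
    have h2 : Complex.I * θ * (3 / 4 * 0 + c * (0 - ((Real.log |θ| : ℝ) : ℂ) -
      Complex.log (-(Complex.I * (θ / |θ| : ℝ))))) = -(Complex.I * c * θ * Real.log |θ|) -
        Complex.I * c * (θ * Complex.log (-(Complex.I * (θ / |θ| : ℝ)))) := by ring
    rw [h2, h1]
    push_cast
    linear_combination (c * (Real.pi / 2) * |θ| : ℂ) * Complex.I_mul_I
  rw [hval] at hlim
  refine hlim.congr' ?_
  filter_upwards [eventually_ge_atTop 1] with k hk
  have hk0 : (0 : ℝ) < k := by exact_mod_cast hk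
  have hkC : (k : ℂ) ≠ 0 := by exact_mod_cast hk0.ne'
  have hw0 : 0 < (k : ℝ) ^ (1 / 4 : ℝ) := Real.rpow_pos_of_pos hk0 _
  have hz0 : 0 < |θ| * (k : ℝ) ^ (1 / 4 : ℝ) := mul_pos (abs_pos.2 hθ) hw0
  -- `k + i ρ = k (1 - i θ k ^ (-3 / 4))`
  have e1 : Complex.log (k + Complex.I * (-(θ * (k : ℝ) ^ (1 / 4 : ℝ)) : ℝ)) =
      Real.log k + Complex.log (1 + Complex.I * (-(θ * (k : ℝ) ^ (-(3 / 4) : ℝ)) : ℝ)) := by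
    rw [← Complex.log_ofReal_mul hk0]
    · congr 1
      have h : (k : ℝ) ^ (1 / 4 : ℝ) = k * (k : ℝ) ^ (-(3 / 4) : ℝ) := by
        nth_rewrite 2 [← Real.rpow_one (k : ℝ)]
        rw [← Real.rpow_add hk0]
        norm_num
      rw [h]
      push_cast
      ring
    · intro h
      have := congrArg Complex.re h
      simp at this
  -- `1 + i ρ = |ρ| (1 / |ρ| - i sign θ)`
  have e2 : Complex.log (1 + Complex.I * (-(θ * (k : ℝ) ^ (1 / 4 : ℝ)) : ℝ)) =
      Real.log |θ| + 1 / 4 * Real.log k + Complex.log (((|θ| * (k : ℝ) ^ (1 / 4 : ℝ))⁻¹ : ℝ) -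
        Complex.I * (θ / |θ| : ℝ)) := by
    have h : (Real.log |θ| + 1 / 4 * Real.log k : ℂ) =
        ((Real.log (|θ| * (k : ℝ) ^ (1 / 4 : ℝ)) : ℝ) : ℂ) := by
      rw [Real.log_mul (abs_pos.2 hθ).ne' hw0.ne', Real.log_rpow hk0]
      push_cast
      ring
    rw [h, ← Complex.log_ofReal_mul hz0]
    · congr 1
      have h1 : ((|θ| : ℝ) : ℂ) ≠ 0 := by exact_mod_cast (abs_pos.2 hθ).ne'
      have h2 : (((k : ℝ) ^ (1 / 4 : ℝ) : ℝ) : ℂ) ≠ 0 := by exact_mod_cast hw0.ne'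
      rw [Complex.ofReal_inv, Complex.ofReal_mul, Complex.ofReal_neg, Complex.ofReal_mul,
        Complex.ofReal_div]
      field_simp
      ring
    · intro h
      have := congrArg Complex.re h
      simp [-mul_inv_rev] at this
      rcases this with h | h
      · exact hθ h
      · exact hw0.ne' (by simpa using h)
  rw [e1, e2]
  push_cast
  ring

theorem tendsto_exp_mul_prod {c θ : ℝ} (hθ : θ ≠ 0) {ε : ℕ → ℝ} (h0 : ∀ k, 0 ≤ ε k)
    (h1 : ∀ k, ε k ≤ 1)
    (hε : Tendsto (fun k : ℕ => (ε k * (k : ℝ) ^ (1 / 4 : ℝ) - c) * Real.log k) atTop (𝓝 0)) :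
    Tendsto (fun k : ℕ => Complex.exp (-(Complex.I * (3 / 4 * c * Real.log k * θ : ℝ))) *
        ∏ j ∈ Finset.Ico 1 k, (1 - ε k * (Complex.I * (-(θ * (k : ℝ) ^ (1 / 4 : ℝ)) : ℝ)) /
          ((j : ℂ) + Complex.I * (-(θ * (k : ℝ) ^ (1 / 4 : ℝ)) : ℝ)))) atTop
      (𝓝 (Complex.exp (-((c * (Real.pi / 2 * |θ|) : ℝ) : ℂ) -
        Complex.I * (c * (θ * Real.log |θ|) : ℝ)))) := by
  have ha := tendsto_mul_rpow hε
  have hεlog := tendsto_mul_one_add_log ha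
  set ρ : ℕ → ℝ := fun k => -(θ * (k : ℝ) ^ (1 / 4 : ℝ)) with hρ
  have hρabs (k : ℕ) : |ρ k| = |θ| * (k : ℝ) ^ (1 / 4 : ℝ) := by
    rw [hρ, abs_neg, abs_mul, abs_of_nonneg (by positivity : (0 : ℝ) ≤ (k : ℝ) ^ (1 / 4 : ℝ))]
  have hρtop : Tendsto (fun k => |ρ k|) atTop atTop := by
    simp_rw [hρabs]
    exact Tendsto.const_mul_atTop (abs_pos.2 hθ)
      ((tendsto_rpow_atTop (by norm_num)).comp tendsto_natCast_atTop_atTop)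
  set S : ℕ → ℂ := fun k => ∑ j ∈ Finset.Ico 1 k, ((j : ℂ) + Complex.I * ρ k)⁻¹ with hS
  set L : ℕ → ℂ := fun k => Complex.log (k + Complex.I * ρ k) - Complex.log (1 + Complex.I * ρ k)
    with hL
  have hδ : Tendsto (fun k => -(ε k * (Complex.I * ρ k) * (S k - L k))) atTop (𝓝 0) := by
    refine squeeze_zero_norm' ?_ hεlog
    filter_upwards [hρtop.eventually_ge_atTop 2, eventually_ge_atTop 1] with k hk2 hk1
    have h := norm_sum_inv_sub_log_le hk2 hk1
    have hpos : 0 < |ρ k| := by linarith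
    have hn : ‖-(ε k * (Complex.I * ρ k) * (S k - L k))‖ = ε k * |ρ k| * ‖S k - L k‖ := by
      simp [abs_of_nonneg (h0 k)]
    rw [hn]
    calc ε k * |ρ k| * ‖S k - L k‖ ≤ ε k * |ρ k| * ((1 + Real.log k) / |ρ k|) :=
          mul_le_mul_of_nonneg_left h (mul_nonneg (h0 k) hpos.le)
      _ = _ := by field_simp
  have hexp := (Complex.continuous_exp.tendsto _).comp ((tendsto_log_exponent hθ hε).add hδ)
  rw [add_zero] at hexp
  have herr : Tendsto (fun k : ℕ =>
      Complex.exp (-(Complex.I * (3 / 4 * c * Real.log k * θ : ℝ))) *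
      (∏ j ∈ Finset.Ico 1 k, (1 - ε k * (Complex.I * ρ k) / ((j : ℂ) + Complex.I * ρ k)) -
        Complex.exp (-(ε k * (Complex.I * ρ k) * S k)))) atTop (𝓝 0) := by
    have hb := (hεlog.mul ha).const_mul |θ|
    rw [zero_mul, mul_zero] at hb
    refine squeeze_zero_norm' ?_ hb
    filter_upwards [hρtop.eventually_gt_atTop 0] with k hk
    rw [norm_mul, Complex.exp_neg, norm_inv, norm_exp_I_mul, inv_one, one_mul]
    refine (norm_prod_one_sub_sub_exp_le (h0 k) (h1 k) (abs_pos.1 hk) k).trans (le_of_eq ?_)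
    rw [hρabs]
    ring
  have := hexp.add herr
  rw [add_zero] at this
  refine this.congr fun k => ?_
  have he : -(ε k * (Complex.I * ρ k) * L k) - Complex.I * (3 / 4 * c * Real.log k * θ : ℝ) +
      -(ε k * (Complex.I * ρ k) * (S k - L k)) =
      -(Complex.I * (3 / 4 * c * Real.log k * θ : ℝ)) + -(ε k * (Complex.I * ρ k) * S k) := by
    ring
  change Complex.exp (-(ε k * (Complex.I * ρ k) * L k) -
    Complex.I * (3 / 4 * c * Real.log k * θ : ℝ) + -(ε k * (Complex.I * ρ k) * (S k - L k))) +
      _ * (_ - _) = _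
  rw [he, Complex.exp_add, mul_sub, add_sub_cancel]

/-- The only consequence of the assumption on `q` that is used. -/
theorem tendsto_one_sub_mul_rpow_sub_mul_log {c : ℝ} {q : ℕ → unitInterval}
    (hq : (fun k : ℕ => (q k : ℝ) - (1 - c * (k : ℝ) ^ (-(1 / 4) : ℝ))) =o[atTop]
      fun k : ℕ => (k : ℝ)⁻¹) :
    Tendsto (fun k : ℕ => ((1 - q k : ℝ) * (k : ℝ) ^ (1 / 4 : ℝ) - c) * Real.log k)
      atTop (𝓝 0) := by
  have h1 := hq.tendsto_div_nhds_zero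
  have h2 : Tendsto (fun k : ℕ => Real.log k / (k : ℝ) ^ (3 / 4 : ℝ)) atTop (𝓝 0) :=
    (isLittleO_log_rpow_atTop (by norm_num)).tendsto_div_nhds_zero.comp
      tendsto_natCast_atTop_atTop
  have h := (h1.mul h2).neg
  rw [mul_zero, neg_zero] at h
  refine h.congr' ?_
  filter_upwards [eventually_ge_atTop 1] with k hk
  have hk0 : (0 : ℝ) < k := by exact_mod_cast hk
  have e1 : (k : ℝ) ^ (-(1 / 4) : ℝ) = ((k : ℝ) ^ (1 / 4 : ℝ))⁻¹ := Real.rpow_neg hk0.le _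
  have e2 : (k : ℝ) ^ (3 / 4 : ℝ) = k / (k : ℝ) ^ (1 / 4 : ℝ) := by
    rw [show (3 / 4 : ℝ) = 1 - 1 / 4 by norm_num, Real.rpow_sub hk0, Real.rpow_one]
  have hw0 : 0 < (k : ℝ) ^ (1 / 4 : ℝ) := Real.rpow_pos_of_pos hk0 _
  rw [e1, e2]
  field_simp
  ring

theorem tendsto_charFun_numCutOff {c : ℝ} {q : ℕ → unitInterval}
    (hq : (fun k : ℕ => (q k : ℝ) - (1 - c * (k : ℝ) ^ (-(1 / 4) : ℝ))) =o[atTop]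
      fun k : ℕ => (k : ℝ)⁻¹) (θ : ℝ) :
    Tendsto (fun n : ℕ => charFun ((percolatedTreeLaw n (q (n + 1))).map
        fun H : SimpleGraph (Fin (n + 1)) =>
          ((n + 1 : ℕ) : ℝ) ^ (-(3 / 4) : ℝ) * (numCutOff H : ℝ)
            - 3 / 4 * c * Real.log ((n + 1 : ℕ) : ℝ)) θ) atTop
      (𝓝 (Complex.exp (-((c * (Real.pi / 2 * |θ|) : ℝ) : ℂ) -
        Complex.I * (c * (θ * Real.log |θ|) : ℝ)))) := by
  rcases eq_or_ne θ 0 with rfl | hθ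
  · have (n : ℕ) := Measure.isProbabilityMeasure_map (μ := percolatedTreeLaw n (q (n + 1)))
      (f := fun H : SimpleGraph (Fin (n + 1)) =>
          ((n + 1 : ℕ) : ℝ) ^ (-(3 / 4) : ℝ) * (numCutOff H : ℝ)
            - 3 / 4 * c * Real.log ((n + 1 : ℕ) : ℝ)) Measurable.of_discrete.aemeasurable
    simp only [charFun_zero, probReal_univ]
    simp
  set ε : ℕ → ℝ := fun k => 1 - q k with hεdef
  have hε := tendsto_one_sub_mul_rpow_sub_mul_log hq
  have hprod := (tendsto_exp_mul_prod hθ (ε := ε) (fun k => sub_nonneg.2 (q k).2.2)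
    (fun k => sub_le_self _ (q k).2.1) hε).comp (tendsto_add_atTop_nat 1)
  have hbound := (tendsto_integral_error (ε := ε) θ (tendsto_mul_rpow hε)).comp
    (tendsto_add_atTop_nat 1)
  set ρ : ℕ → ℝ := fun k => -(θ * (k : ℝ) ^ (1 / 4 : ℝ)) with hρ
  have herr : Tendsto (fun n : ℕ =>
      Complex.exp (-(Complex.I * (3 / 4 * c * Real.log (n + 1 : ℕ) * θ : ℝ))) *
      (∫ H, Complex.exp (-(Complex.I * (ρ (n + 1) * numCutOff H / (n + 1 : ℕ) : ℝ)))
          ∂percolatedTreeLaw n (q (n + 1)) -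
        ∫ H, ∏ j ∈ Finset.Ico (n + 1 - numCutOff H) (n + 1),
          (1 + Complex.I * ρ (n + 1) / (j : ℂ))⁻¹ ∂percolatedTreeLaw n (q (n + 1))))
      atTop (𝓝 0) := by
    refine squeeze_zero_norm (fun n => ?_) hbound
    rw [norm_mul, Complex.exp_neg, norm_inv, norm_exp_I_mul, inv_one, one_mul, norm_sub_rev]
    exact norm_integral_sub_le _ _ _
  have := hprod.add herr
  rw [add_zero] at this
  refine this.congr fun n => ?_
  rw [Function.comp_apply, mul_sub, integral_prod_inv_numCutOff _ (by simp), add_sub_cancel,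
    charFun_apply_real, integral_map Measurable.of_discrete.aemeasurable (by fun_prop),
    ← integral_const_mul]
  congr 1
  ext H
  rw [← Complex.exp_add]
  congr 1
  have hk0 : (0 : ℝ) < (n + 1 : ℕ) := by positivity
  have e1 : ((n + 1 : ℕ) : ℝ) ^ (-(3 / 4) : ℝ) = ((n + 1 : ℕ) : ℝ) ^ (1 / 4 : ℝ) / (n + 1 : ℕ) := by
    rw [show (-(3 / 4) : ℝ) = 1 / 4 - 1 by norm_num, Real.rpow_sub hk0, Real.rpow_one]
  rw [e1, hρ]
  push_cast
  ring

/-- **Lévy's continuity theorem**, with existence of the limit law: tightness follows from the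
continuity of the limit at `0`, and Prokhorov's theorem provides a subsequential limit whose
characteristic function is `φ`. -/
theorem exists_probabilityMeasure_charFun_eq {μ : ℕ → ProbabilityMeasure ℝ} {φ : ℝ → ℂ}
    (hφ : ContinuousAt φ 0)
    (h : ∀ t, Tendsto (fun n => charFun (μ n : Measure ℝ) t) atTop (𝓝 (φ t))) :
    ∃ ν : ProbabilityMeasure ℝ, (∀ t, charFun (ν : Measure ℝ) t = φ t) ∧
      Tendsto μ atTop (𝓝 ν) := by
  have ht := isTightMeasureSet_of_tendsto_charFun hφ h
  have hc : IsCompact (closure (Set.range μ)) := by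
    refine isCompact_closure_of_isTightMeasureSet ?_
    convert ht using 1
    ext
    simp
  obtain ⟨ν, -, u, hu, hν⟩ := hc.isSeqCompact fun n => subset_closure (Set.mem_range_self n)
  have hchar : ∀ t, charFun (ν : Measure ℝ) t = φ t := fun t =>
    tendsto_nhds_unique (ProbabilityMeasure.tendsto_iff_tendsto_charFun.1 hν t)
      ((h t).comp hu.tendsto_atTop)
  exact ⟨ν, hchar, ProbabilityMeasure.tendsto_of_tendsto_charFun fun t => by
    rw [hchar]; exact h t⟩

end RandomRecursiveTree

theorem proposition1 (c : ℝ) (hc : 0 < c) (q : ℕ → unitInterval)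
    (hq : (fun k : ℕ => (q k : ℝ) - (1 - c * (k : ℝ) ^ (-(1 / 4) : ℝ))) =o[atTop]
      fun k : ℕ => (k : ℝ)⁻¹) :
    ∃ ν : ProbabilityMeasure ℝ, RandomRecursiveTree.IsContinuousLuriaDelbruck ν ∧
      TendstoInDistribution
        (fun (n : ℕ) (H : SimpleGraph (Fin (n + 1))) =>
          ((n + 1 : ℕ) : ℝ) ^ (-(3 / 4) : ℝ) * (RandomRecursiveTree.numCutOff H : ℝ)
            - 3 / 4 * c * Real.log ((n + 1 : ℕ) : ℝ))
        atTop
        (fun z : ℝ => c * (z + Real.log c))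
        (fun n : ℕ => RandomRecursiveTree.percolatedTreeLaw n (q (n + 1)))
        (ν : Measure ℝ) := by
  have hmeas (n : ℕ) : AEMeasurable (fun H : SimpleGraph (Fin (n + 1)) =>
      ((n + 1 : ℕ) : ℝ) ^ (-(3 / 4) : ℝ) * (RandomRecursiveTree.numCutOff H : ℝ)
        - 3 / 4 * c * Real.log ((n + 1 : ℕ) : ℝ))
      (RandomRecursiveTree.percolatedTreeLaw n (q (n + 1))) :=
    Measurable.of_discrete.aemeasurable
  let μ : ℕ → ProbabilityMeasure ℝ := fun n =>
    ⟨_, Measure.isProbabilityMeasure_map (hmeas n)⟩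
  have hcont : ContinuousAt (fun θ : ℝ => Complex.exp (-((c * (Real.pi / 2 * |θ|) : ℝ) : ℂ) -
      Complex.I * (c * (θ * Real.log |θ|) : ℝ))) 0 := by
    have h : Continuous fun θ : ℝ => θ * Real.log |θ| := by
      simpa only [Real.log_abs] using Real.continuous_mul_log
    have h' : Continuous fun θ : ℝ => Complex.exp (-((c * (Real.pi / 2 * |θ|) : ℝ) : ℂ) -
      Complex.I * (c * (θ * Real.log |θ|) : ℝ)) := by fun_prop
    exact h'.continuousAt
  obtain ⟨ν', hν', hlim⟩ := RandomRecursiveTree.exists_probabilityMeasure_charFun_eq (μ := μ) hcont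
    fun θ => RandomRecursiveTree.tendsto_charFun_numCutOff hq θ
  -- the inverse of the affine map `z ↦ c * (z + log c)`
  have hT : Measurable fun x : ℝ => c⁻¹ * x + -Real.log c := by fun_prop
  let ν : ProbabilityMeasure ℝ :=
    ⟨_, Measure.isProbabilityMeasure_map (μ := (ν' : Measure ℝ)) hT.aemeasurable⟩
  refine ⟨ν, fun θ => ?_, hmeas, by fun_prop, ?_⟩
  · have hcomp : (ν' : Measure ℝ).map (fun x : ℝ => c⁻¹ * x + -Real.log c) =
        ((ν' : Measure ℝ).map (c⁻¹ * ·)).map (· + -Real.log c) := by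
      rw [Measure.map_map (by fun_prop) (by fun_prop)]
      rfl
    change charFun ((ν' : Measure ℝ).map (fun x : ℝ => c⁻¹ * x + -Real.log c)) θ = _
    rw [hcomp, charFun_map_add_const, charFun_map_mul, hν', ← Complex.exp_add]
    congr 1
    have hlog : c * (c⁻¹ * θ * Real.log |c⁻¹ * θ|) = θ * Real.log |θ| - θ * Real.log c := by
      rcases eq_or_ne θ 0 with rfl | hθ
      · simp
      · rw [abs_mul, abs_of_pos (inv_pos.2 hc), Real.log_mul (inv_pos.2 hc).ne'
          (abs_pos.2 hθ).ne', Real.log_inv]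
        field_simp
        ring
    have habs : c * (Real.pi / 2 * |c⁻¹ * θ|) = Real.pi / 2 * |θ| := by
      rw [abs_mul, abs_of_pos (inv_pos.2 hc)]
      field_simp
    rw [hlog, habs]
    simp
    ring
  · have hback : (ν : Measure ℝ).map (fun z : ℝ => c * (z + Real.log c)) = (ν' : Measure ℝ) := by
      change ((ν' : Measure ℝ).map fun x : ℝ => c⁻¹ * x + -Real.log c).map
        (fun z : ℝ => c * (z + Real.log c)) = (ν' : Measure ℝ)
      have hid : (fun z : ℝ => c * (z + Real.log c)) ∘ (fun x : ℝ => c⁻¹ * x + -Real.log c) =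
          id := by
        ext x
        simp [hc.ne']
      rw [Measure.map_map (by fun_prop) (by fun_prop), hid, Measure.map_id]
    convert hlim using 2
    exact congrArg nhds (Subtype.ext hback)
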